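/- Let $Q$ be a finite quiver with vertex set $I$, set of arrows also denoted $Q$, and head and tail maps $h,t:Q\to I$. Let $\overline Q$ be its double, with an additional arrow $b^*$ from $h(b)$ to $t(b)$ for every arrow $b$. Let $\mathbb C\overline Q$ be its path algebra (paths are composed from right to left) and let $\mathbb C\overline Q^r$ be the span of the paths containing exactly $r$ dual arrows. Let $\mathcal V Q$ be the quotient of the vector space $\mathbb C\overline Q$ by the linear span of all $PR-(-1)^{pr}RP$ with $P\in\mathbb C\overline Q^p$, $R\in\mathbb C\overline Q^r$, and let $\mathcal V^rQ$ be the image of $\mathbb C\overline Q^r$. (Paths that are not closed are zero in $\mathcal VQ$.) For $c\in\overline Q$ let $D_c:\mathcal VQ\to\mathbb C\overline Q$ be the linear map given on closed paths by $$D_c(x_1\cdots x_n)=\sum_{k:\,x_k=c}(-1)^{\lambda_k\mu_k}\,x_{k+1}\cdots x_nx_1\cdots x_{k-1},$$ where $\lambda_k$ (resp. $\mu_k$) is the number of dual arrows among $x_{k+1},\dots,x_n$ (resp. $x_1,\dots,x_k$), and the empty product is the trivial path at $t(c)$. For $\gamma\in\mathcal V^rQ$, $\delta\in\mathcal V^sQ$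 let $$[\gamma,\delta]=\sum_{b\in Q}\Bigl(D_{b^*}(\gamma)D_b(\delta)-(-1)^{(r-1)(s-1)}D_{b^*}(\delta)D_b(\gamma)\Bigr)\in\mathcal VQ .$$ A Poisson structure on $\mathbb CQ$ is an element $\Pi\in\mathcal V^2Q$ with $[\Pi,\Pi]=0$. Let $a\in Q$ be an arrow whose tail $i=t(a)$ and head $j=h(a)$ are distinct, and let $Q_a$ be the quiver obtained from $Q$ by fusing $i$ and $j$ and deleting $a$. Put $S_j=\{b\in Q: h(b)=j\}$ and $T_j=\{b\in Q: t(b)=j\}$. For $\Pi\in\mathcal VQ$ let $\Pi_a\in\mathcal VQ_a$ be obtained by writing $\Pi$ as a linear combination of closed paths of $\overline Q$ and replacing in each of them $a$ by $1$ and $a^*$ by $$\sum_{b\in T_j}b^*b-\sum_{b\in S_j,\ b\neq a}bb^* .$$ **Proposition.** The element $\Pi_a$ is well defined, and if $\Pi$ is a Poisson structure on $\mathbb CQ$, then $\Pi_a$ is a Poisson structure on $\mathbb CQ_a$. -/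

import Mathlib

set_option linter.unusedSectionVars false

noncomputable section

/-- A quiver with vertex set `I` and arrow set `E`: every arrow has a head and a tail. -/
structure ArrowQuiver (I E : Type*) where
  head : E → I
  tail : E → I

namespace ArrowQuiver

universe u v

variable {I : Type u} {E : Type v}

/-- `Q.IsPath i [x₁, …, xₙ] j`: the word `x₁ ⋯ xₙ`, read from right to left, is a path
from `j` to `i`, that is, `i = h(x₁)`, `t(xₖ) = h(xₖ₊₁)` and `t(xₙ) = j`. -/
def IsPath (Q : ArrowQuiver I E) : I → List E → I → Prop
  | i, [], j => i = j
  | i, x :: w, j => i = Q.head x ∧ IsPath Q (Q.tail x) w j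

theorem IsPath.append {Q : ArrowQuiver I E} {u w : List E} {i j k : I}
    (hu : Q.IsPath i u j) (hw : Q.IsPath j w k) : Q.IsPath i (u ++ w) k := by
  induction u generalizing i with
  | nil => obtain rfl : i = j := hu; exact hw
  | cons x u ih => exact ⟨hu.1, ih hu.2⟩

/-- A path of `Q` (trivial paths included): a word of arrows with its two end points. -/
@[ext] structure Path (Q : ArrowQuiver I E) where
  tgt : I
  word : List E
  src : I
  isPath : Q.IsPath tgt word src

namespace Path

variable {Q : ArrowQuiver I E}

/-- The trivial path at a vertex. -/
def triv (Q : ArrowQuiver I E) (i : I) : Q.Path := ⟨i, [], i, rfl⟩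

/-- An arrow, as a path of length one. -/
def ofArrow (Q : ArrowQuiver I E) (x : E) : Q.Path :=
  ⟨Q.head x, [x], Q.tail x, rfl, rfl⟩

/-- Concatenation `p q` of paths: first `q`, then `p`. -/
def comp (p q : Q.Path) (h : p.src = q.tgt) : Q.Path :=
  ⟨p.tgt, p.word ++ q.word, q.src, p.isPath.append (by rw [h]; exact q.isPath)⟩

end Path

/-- The path algebra `ℂQ`: the complex vector space with the paths of `Q` as a basis. Its
product (below) is concatenation of paths, and zero for paths that cannot be concatenated. -/
def PathAlgebra (Q : ArrowQuiver I E) : Type (max u v) := Q.Path →₀ ℂ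

namespace PathAlgebra

variable {Q : ArrowQuiver I E}

instance : AddCommGroup Q.PathAlgebra := inferInstanceAs (AddCommGroup (Q.Path →₀ ℂ))
instance : Module ℂ Q.PathAlgebra := inferInstanceAs (Module ℂ (Q.Path →₀ ℂ))

/-- A path as an element of the path algebra. -/
def of (p : Q.Path) : Q.PathAlgebra := Finsupp.single p (1 : ℂ)

/-- The linear map on the path algebra with prescribed values on the paths. -/
def lift {M : Type*} [AddCommGroup M] [Module ℂ M] (f : Q.Path → M) : Q.PathAlgebra →ₗ[ℂ] M :=
  Finsupp.linearCombination ℂ f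

@[simp] theorem lift_of {M : Type*} [AddCommGroup M] [Module ℂ M] (f : Q.Path → M)
    (p : Q.Path) : lift f (of p) = f p :=
  (Finsupp.linearCombination_single ℂ (1 : ℂ) p).trans (one_smul ℂ _)

theorem induction {P : Q.PathAlgebra → Prop} (x : Q.PathAlgebra) (h0 : P 0)
    (hadd : ∀ x y, P x → P y → P (x + y)) (hof : ∀ (c : ℂ) (p : Q.Path), P (c • of p)) : P x := by
  refine Finsupp.induction_linear (motive := P) x h0 hadd fun p c => ?_
  have h : (Finsupp.single p c : Q.Path →₀ ℂ) = c • Finsupp.single p (1 : ℂ) := by simp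
  exact (congrArg (α := Q.Path →₀ ℂ) P h).mpr (hof c p)

variable [DecidableEq I]

/-- The product of two paths in the path algebra. -/
def pathMul (p q : Q.Path) : Q.PathAlgebra :=
  if h : p.src = q.tgt then of (p.comp q h) else 0

/-- The product of the path algebra, as a bilinear map. -/
def mulMap (Q : ArrowQuiver I E) : Q.PathAlgebra →ₗ[ℂ] Q.PathAlgebra →ₗ[ℂ] Q.PathAlgebra :=
  lift fun p => lift fun q => pathMul p q

instance : Mul Q.PathAlgebra := ⟨fun x y => mulMap Q x y⟩

theorem mul_def (x y : Q.PathAlgebra) : x * y = mulMap Q x y := rfl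

theorem of_mul_of (p q : Q.Path) : of p * of q = pathMul p q := by
  simp [mul_def, mulMap]

theorem of_mul_of_pos (p q : Q.Path) (h : p.src = q.tgt) : of p * of q = of (p.comp q h) := by
  simp [of_mul_of, pathMul, h]

theorem of_mul_of_neg (p q : Q.Path) (h : p.src ≠ q.tgt) : of p * of q = 0 := by
  simp [of_mul_of, pathMul, h]

/-- The idempotent `e_i`. -/
def e (Q : ArrowQuiver I E) (i : I) : Q.PathAlgebra := of (Path.triv Q i)

theorem e_mul_of (i : I) (p : Q.Path) : e Q i * of p = if i = p.tgt then of p else 0 := by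
  by_cases h : i = p.tgt
  · rw [e, of_mul_of_pos _ _ h, if_pos h]
    subst h
    rfl
  · rw [e, of_mul_of_neg _ _ h, if_neg h]

theorem of_mul_e (i : I) (p : Q.Path) : of p * e Q i = if p.src = i then of p else 0 := by
  by_cases h : p.src = i
  · rw [e, of_mul_of_pos _ _ h, if_pos h]
    subst h
    congr 1
    ext <;> simp [Path.comp, Path.triv]
  · rw [e, of_mul_of_neg _ _ h, if_neg h]

theorem smul_mul' (c : ℂ) (x y : Q.PathAlgebra) : c • x * y = c • (x * y) := by
  simp [mul_def]

theorem mul_smul' (c : ℂ) (x y : Q.PathAlgebra) : x * c • y = c • (x * y) := by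
  simp [mul_def]

theorem add_mul' (x y z : Q.PathAlgebra) : (x + y) * z = x * z + y * z := by
  simp [mul_def]

theorem mul_add' (x y z : Q.PathAlgebra) : x * (y + z) = x * y + x * z := by
  simp [mul_def]

theorem zero_mul' (x : Q.PathAlgebra) : 0 * x = 0 := by simp [mul_def]

theorem mul_zero' (x : Q.PathAlgebra) : x * 0 = 0 := by simp [mul_def]

theorem of_mul_assoc (p q r : Q.Path) : of p * of q * of r = of p * (of q * of r) := by
  by_cases h : p.src = q.tgt <;> by_cases h' : q.src = r.tgt
  · rw [of_mul_of_pos p q h, of_mul_of_pos q r h', of_mul_of_pos (p.comp q h) r h',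
      of_mul_of_pos p (q.comp r h') h]
    congr 1
    ext <;> simp [Path.comp]
  · rw [of_mul_of_pos p q h, of_mul_of_neg q r h', of_mul_of_neg (p.comp q h) r h', mul_zero']
  · rw [of_mul_of_neg p q h, of_mul_of_pos q r h', of_mul_of_neg p (q.comp r h') h, zero_mul']
  · rw [of_mul_of_neg p q h, of_mul_of_neg q r h', mul_zero', zero_mul']

theorem mul_assoc' (x y z : Q.PathAlgebra) : x * y * z = x * (y * z) := by
  induction x using induction with
  | h0 => simp only [zero_mul']
  | hadd a b ha hb => simp only [add_mul', ha, hb]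
  | hof c p =>
  induction y using induction with
  | h0 => simp only [zero_mul', mul_zero']
  | hadd a b ha hb => simp only [add_mul', mul_add', ha, hb]
  | hof d q =>
  induction z using induction with
  | h0 => simp only [mul_zero']
  | hadd a b ha hb => simp only [mul_add', ha, hb]
  | hof f r => simp only [smul_mul', mul_smul', of_mul_assoc]

variable [Fintype I]

instance : One Q.PathAlgebra := ⟨∑ i, e Q i⟩

theorem one_def : (1 : Q.PathAlgebra) = ∑ i, e Q i := rfl

theorem one_mul' (x : Q.PathAlgebra) : 1 * x = x := by
  induction x using induction with
  | h0 => exact mul_zero' _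
  | hadd a b ha hb => rw [mul_add', ha, hb]
  | hof c p =>
    have h : (1 : Q.PathAlgebra) * of p = ∑ i, e Q i * of p := by
      rw [one_def, mul_def, map_sum, LinearMap.sum_apply]; rfl
    rw [mul_smul', h]
    simp [e_mul_of]

theorem mul_one' (x : Q.PathAlgebra) : x * 1 = x := by
  induction x using induction with
  | h0 => exact zero_mul' _
  | hadd a b ha hb => rw [add_mul', ha, hb]
  | hof c p =>
    have h : of p * (1 : Q.PathAlgebra) = ∑ i, of p * e Q i := by
      rw [one_def, mul_def, map_sum]; rfl
    rw [smul_mul', h]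
    simp [of_mul_e]

instance : Ring Q.PathAlgebra :=
  { (inferInstance : AddCommGroup Q.PathAlgebra) with
    mul := (· * ·)
    one := 1
    left_distrib := mul_add'
    right_distrib := add_mul'
    zero_mul := zero_mul'
    mul_zero := mul_zero'
    mul_assoc := mul_assoc'
    one_mul := one_mul'
    mul_one := mul_one' }

instance : Algebra ℂ Q.PathAlgebra := Algebra.ofModule smul_mul' mul_smul'

/-- The arrows as elements of the path algebra. -/
def arrow (Q : ArrowQuiver I E) (x : E) : Q.PathAlgebra := of (Path.ofArrow Q x)

end PathAlgebra

open PathAlgebra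

/-- The double quiver: `Sum.inl a` is the arrow `a`, and `Sum.inr a` the dual arrow `a*`. -/
def double (Q : ArrowQuiver I E) : ArrowQuiver I (E ⊕ E) where
  head := Sum.elim Q.head Q.tail
  tail := Sum.elim Q.tail Q.head

/-- The number of dual arrows in a word of arrows of the double quiver. -/
def numDual (w : List (E ⊕ E)) : ℕ := w.countP Sum.isRight

theorem numDual_append (u w : List (E ⊕ E)) : numDual (u ++ w) = numDual u + numDual w :=
  List.countP_append

/-- The subspace of `ℂQ̄` spanned by the paths with exactly `r` dual arrows. -/
def grade (Q : ArrowQuiver I E) (r : ℕ) : Submodule ℂ Q.double.PathAlgebra :=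
  Submodule.span ℂ {x | ∃ p : Q.double.Path, numDual p.word = r ∧ x = of p}

variable [Fintype I] [DecidableEq I]

/-- The linear span of all `P R - (-1)^(pr) R P`, for `P`, `R` homogeneous of degrees `p`, `r`. -/
def superCommutators (Q : ArrowQuiver I E) : Submodule ℂ Q.double.PathAlgebra :=
  Submodule.span ℂ {x | ∃ p r : ℕ, ∃ P ∈ Q.grade p, ∃ R ∈ Q.grade r,
    x = P * R - (-1 : ℂ) ^ (p * r) • (R * P)}

/-- The space of noncommutative polyvector fields (necklaces): the quotient of the vector space
`ℂQ̄` by the relations `P R = (-1)^(pr) R P`. -/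
abbrev Necklace (Q : ArrowQuiver I E) : Type (max u v) :=
  Q.double.PathAlgebra ⧸ Q.superCommutators

/-- The subspace of necklaces of degree `r`. -/
def necklaceGrade (Q : ArrowQuiver I E) (r : ℕ) : Submodule ℂ Q.Necklace :=
  (Q.grade r).map Q.superCommutators.mkQ

/-- A linear map satisfying the relations on paths satisfies them everywhere. -/
theorem superCommutators_le_ker {Q : ArrowQuiver I E} {M : Type*} [AddCommGroup M] [Module ℂ M]
    (f : Q.double.PathAlgebra →ₗ[ℂ] M)
    (hf : ∀ p q : Q.double.Path,
      f (of p * of q) = (-1 : ℂ) ^ (numDual p.word * numDual q.word) • f (of q * of p)) :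
    Q.superCommutators ≤ LinearMap.ker f := by
  refine Submodule.span_le.2 ?_
  rintro _ ⟨p, r, P, hP, R, hR, rfl⟩
  suffices h : f (P * R) = (-1 : ℂ) ^ (p * r) • f (R * P) by
    simp [LinearMap.mem_ker, h]
  induction hP using Submodule.span_induction with
  | zero => simp
  | add x y _ _ hx hy => simp [add_mul, mul_add, hx, hy]
  | smul c x _ hx => simp [hx, smul_comm c]
  | mem x hx =>
    obtain ⟨p', rfl, rfl⟩ := hx
    induction hR using Submodule.span_induction with
    | zero => simp
    | add x y _ _ hx hy => simp [add_mul, mul_add, hx, hy]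
    | smul c x _ hx => simp [hx, smul_comm c]
    | mem x hx =>
      obtain ⟨q', rfl, rfl⟩ := hx
      exact hf p' q'

/-- A map on paths that respects rotation of closed paths, extended by zero to the paths that are
not closed, satisfies the relations. -/
theorem closed_rotation {Q : ArrowQuiver I E} {M : Type*} [AddCommGroup M] [Module ℂ M]
    (g : Q.double.Path → M)
    (hg : ∀ (p q : Q.double.Path) (h : p.src = q.tgt) (h' : q.src = p.tgt),
      g (p.comp q h) = (-1 : ℂ) ^ (numDual p.word * numDual q.word) • g (q.comp p h')) :
    Q.superCommutators ≤ LinearMap.ker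
      (lift fun p : Q.double.Path => if p.tgt = p.src then g p else 0) := by
  refine superCommutators_le_ker _ fun p q => ?_
  by_cases h : p.src = q.tgt <;> by_cases h' : q.src = p.tgt
  · rw [of_mul_of_pos p q h, of_mul_of_pos q p h', lift_of, lift_of,
      if_pos (show (p.comp q h).tgt = (p.comp q h).src from h'.symm),
      if_pos (show (q.comp p h').tgt = (q.comp p h').src from h.symm)]
    exact hg p q h h'
  · rw [of_mul_of_pos p q h, of_mul_of_neg q p h', lift_of]
    simp [Path.comp, Ne.symm h']
  · rw [of_mul_of_neg p q h, of_mul_of_pos q p h', lift_of]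
    simp [Path.comp, Ne.symm h]
  · rw [of_mul_of_neg p q h, of_mul_of_neg q p h']
    simp

variable [DecidableEq E]

/-- The sum, over the positions `k` with `xₖ = c`, of
`(-1)^(λₖ μₖ) xₖ₊₁ ⋯ xₙ x₁ ⋯ xₖ₋₁`, where `λₖ` is the number of dual arrows among
`xₖ₊₁, …, xₙ` and `μₖ` the number of dual arrows among `x₁, …, xₖ`. The factor
`e_{t(c)}` only matters for the empty word, which stands for the trivial path at `t(c)`.
(In the code positions are counted from `0`.) -/
def wordDeriv (Q : ArrowQuiver I E) (c : E ⊕ E) (w : List (E ⊕ E)) : Q.double.PathAlgebra :=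
  ∑ k ∈ Finset.range w.length, if w[k]? = some c then
    (-1 : ℂ) ^ (numDual (w.drop (k + 1)) * numDual (w.take (k + 1))) •
      (e Q.double (Q.double.tail c) *
        ((w.drop (k + 1) ++ w.take k).map (arrow Q.double)).prod)
  else 0

theorem wordDeriv_rotate (Q : ArrowQuiver I E) (c : E ⊕ E) (u w : List (E ⊕ E)) :
    Q.wordDeriv c (u ++ w) = (-1 : ℂ) ^ (numDual u * numDual w) • Q.wordDeriv c (w ++ u) := by
  have key : ∀ (u w : List (E ⊕ E)), ∀ k < u.length,
      (if (u ++ w)[k]? = some c then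
        (-1 : ℂ) ^ (numDual ((u ++ w).drop (k + 1)) * numDual ((u ++ w).take (k + 1))) •
          (e Q.double (Q.double.tail c) *
            (((u ++ w).drop (k + 1) ++ (u ++ w).take k).map (arrow Q.double)).prod)
        else 0) =
      (-1 : ℂ) ^ (numDual u * numDual w) •
      (if (w ++ u)[w.length + k]? = some c then
        (-1 : ℂ) ^ (numDual ((w ++ u).drop (w.length + k + 1)) *
            numDual ((w ++ u).take (w.length + k + 1))) •
          (e Q.double (Q.double.tail c) *
            (((w ++ u).drop (w.length + k + 1) ++ (w ++ u).take (w.length + k)).map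
              (arrow Q.double)).prod)
        else 0) := by
    intro u w k hk
    have e1 : (u ++ w)[k]? = u[k]? := List.getElem?_append_left hk
    have e2 : (w ++ u)[w.length + k]? = u[k]? := by
      rw [List.getElem?_append_right (by omega)]; congr 1; omega
    have e3 : (u ++ w).drop (k + 1) = u.drop (k + 1) ++ w :=
      List.drop_append_of_le_length (by omega)
    have e4 : (u ++ w).take (k + 1) = u.take (k + 1) := List.take_append_of_le_length (by omega)
    have e5 : (u ++ w).take k = u.take k := List.take_append_of_le_length (by omega)
    have e6 : (w ++ u).drop (w.length + k + 1) = u.drop (k + 1) := by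
      rw [add_assoc, List.drop_append]; simp
    have e7 : (w ++ u).take (w.length + k + 1) = w ++ u.take (k + 1) := by
      rw [add_assoc, List.take_append]; simp
    have e8 : (w ++ u).take (w.length + k) = w ++ u.take k := by
      rw [List.take_append]; simp
    have e9 : numDual u = numDual (u.take (k + 1)) + numDual (u.drop (k + 1)) := by
      rw [← numDual_append, List.take_append_drop]
    rw [e1, e2, e3, e4, e5, e6, e7, e8, e9]
    split_ifs
    · rw [smul_smul, List.append_assoc]
      congr 1
      rw [numDual_append, numDual_append, ← pow_add]
      refine neg_one_pow_congr ?_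
      simp only [Nat.even_add, Nat.even_mul]
      tauto
    · simp
  unfold wordDeriv
  rw [List.length_append, List.length_append, Finset.sum_range_add, Finset.sum_range_add,
    add_comm, smul_add]
  congr 1
  · rw [Finset.smul_sum]
    refine Finset.sum_congr rfl fun k hk => ?_
    have h := key w u k (Finset.mem_range.1 hk)
    rw [h, smul_smul, ← pow_add, mul_comm (numDual w), ← two_mul, pow_mul]
    simp
  · rw [Finset.smul_sum]
    refine Finset.sum_congr rfl fun k hk => ?_
    exact key u w k (Finset.mem_range.1 hk)

/-- The directional superderivative `D_c` on necklaces, for an arrow `c` of the double quiver.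
(Paths that are not closed are zero as necklaces.) -/
def superDeriv (Q : ArrowQuiver I E) (c : E ⊕ E) : Q.Necklace →ₗ[ℂ] Q.double.PathAlgebra :=
  Q.superCommutators.liftQ
    (lift fun p : Q.double.Path => if p.tgt = p.src then Q.wordDeriv c p.word else 0)
    (closed_rotation (fun p => Q.wordDeriv c p.word) fun p q _ _ =>
      Q.wordDeriv_rotate c p.word q.word)

variable [Fintype E]

/-- The Schouten bracket of a necklace `γ` of degree `r` and a necklace `δ` of degree `s`. -/
def schouten (Q : ArrowQuiver I E) (r s : ℕ) (γ δ : Q.Necklace) : Q.Necklace :=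
  Q.superCommutators.mkQ (∑ a : E,
    (Q.superDeriv (Sum.inr a) γ * Q.superDeriv (Sum.inl a) δ -
      (-1 : ℂ) ^ (((r : ℤ) - 1) * ((s : ℤ) - 1)) •
        (Q.superDeriv (Sum.inr a) δ * Q.superDeriv (Sum.inl a) γ)))

/-- A Poisson structure on `ℂQ`: a necklace of degree `2` whose Schouten bracket with itself
vanishes. -/
def IsPoisson (Q : ArrowQuiver I E) (P : Q.Necklace) : Prop :=
  P ∈ Q.necklaceGrade 2 ∧ Q.schouten 2 2 P P = 0

/-- Fusing the end points of an arrow `a` with distinct end points `i = t(a)` and `j = h(a)`: the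
vertex `j` is left out, and `i` stands for the fused vertex. -/
def fuse (Q : ArrowQuiver I E) (a : E) (ha : Q.head a ≠ Q.tail a) (v : I) :
    {v : I // v ≠ Q.head a} :=
  if h : v = Q.head a then ⟨Q.tail a, ha.symm⟩ else ⟨v, h⟩

/-- The quiver `Q_a`: `Q` with the arrow `a` contracted. -/
def contract (Q : ArrowQuiver I E) (a : E) (ha : Q.head a ≠ Q.tail a) :
    ArrowQuiver {v : I // v ≠ Q.head a} {b : E // b ≠ a} where
  head b := Q.fuse a ha (Q.head b)
  tail b := Q.fuse a ha (Q.tail b)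

/-- The element that replaces an arrow of the double of `Q`: with `j = h(a)`, the arrow `a` is
replaced by `1`, its dual `a*` by `∑_{t(b) = j} b* b - ∑_{h(b) = j, b ≠ a} b b*`, and all other
arrows are kept. (The first sum leaves out nothing, as `t(a) ≠ j`.) -/
def contractArrow (Q : ArrowQuiver I E) (a : E) (ha : Q.head a ≠ Q.tail a) :
    E ⊕ E → (Q.contract a ha).double.PathAlgebra
  | Sum.inl b => if h : b = a then 1 else arrow (Q.contract a ha).double (Sum.inl ⟨b, h⟩)
  | Sum.inr b => if h : b = a then
      (∑ c ∈ Finset.univ.filter (fun c : {b : E // b ≠ a} => Q.tail c = Q.head a),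
        arrow (Q.contract a ha).double (Sum.inr c) * arrow (Q.contract a ha).double (Sum.inl c)) -
      (∑ c ∈ Finset.univ.filter (fun c : {b : E // b ≠ a} => Q.head c = Q.head a),
        arrow (Q.contract a ha).double (Sum.inl c) * arrow (Q.contract a ha).double (Sum.inr c))
    else arrow (Q.contract a ha).double (Sum.inr ⟨b, h⟩)

/-- The substitution, on a path `x₁ ⋯ xₙ` with head `i`. -/
def contractPath (Q : ArrowQuiver I E) (a : E) (ha : Q.head a ≠ Q.tail a) (p : Q.double.Path) :
    (Q.contract a ha).double.PathAlgebra :=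
  e (Q.contract a ha).double (Q.fuse a ha p.tgt) * (p.word.map (Q.contractArrow a ha)).prod

theorem e_mul_arrow {Q : ArrowQuiver I E} (x : E) {i : I} (h : i = Q.head x) :
    e Q i * arrow Q x = arrow Q x := by
  exact (e_mul_of i (Path.ofArrow Q x)).trans (if_pos h)

theorem arrow_mul_e {Q : ArrowQuiver I E} (x : E) {i : I} (h : Q.tail x = i) :
    arrow Q x * e Q i = arrow Q x := by
  exact (of_mul_e i (Path.ofArrow Q x)).trans (if_pos h)

theorem e_mul_e {Q : ArrowQuiver I E} (i : I) : e Q i * e Q i = e Q i := by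
  exact (e_mul_of i (Path.triv Q i)).trans (if_pos rfl)

theorem fuse_head (Q : ArrowQuiver I E) (a : E) (ha : Q.head a ≠ Q.tail a) :
    Q.fuse a ha (Q.head a) = Q.fuse a ha (Q.tail a) := by
  simp [fuse, ha.symm]

theorem e_mul_contractArrow (Q : ArrowQuiver I E) (a : E) (ha : Q.head a ≠ Q.tail a)
    (x : E ⊕ E) :
    e (Q.contract a ha).double (Q.fuse a ha (Q.double.head x)) * Q.contractArrow a ha x =
      Q.contractArrow a ha x * e (Q.contract a ha).double (Q.fuse a ha (Q.double.tail x)) := by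
  rcases x with b | b
  · by_cases h : b = a
    · subst h
      simp only [contractArrow, dif_pos, mul_one, one_mul]
      exact congrArg _ (Q.fuse_head b ha)
    · simp only [contractArrow, dif_neg h]
      rw [e_mul_arrow, arrow_mul_e] <;> rfl
  · by_cases h : b = a
    · subst h
      have h1 : Q.fuse b ha (Q.double.head (Sum.inr b)) = Q.fuse b ha (Q.head b) :=
        (Q.fuse_head b ha).symm
      have h2 : Q.fuse b ha (Q.double.tail (Sum.inr b)) = Q.fuse b ha (Q.head b) := rfl
      simp only [contractArrow, dif_pos, h1, h2, mul_sub, sub_mul, Finset.mul_sum, Finset.sum_mul]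
      congr 1
      · refine Finset.sum_congr rfl fun c hc => ?_
        have hc : Q.tail c = Q.head b := by simpa using hc
        rw [← mul_assoc, mul_assoc _ _ (e _ _), e_mul_arrow, arrow_mul_e] <;>
          simp [double, contract, hc]
      · refine Finset.sum_congr rfl fun c hc => ?_
        have hc : Q.head c = Q.head b := by simpa using hc
        rw [← mul_assoc, mul_assoc _ _ (e _ _), e_mul_arrow, arrow_mul_e] <;>
          simp [double, contract, hc]
    · simp only [contractArrow, dif_neg h]
      rw [e_mul_arrow, arrow_mul_e] <;> rfl

theorem e_mul_contractWord (Q : ArrowQuiver I E) (a : E) (ha : Q.head a ≠ Q.tail a)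
    (w : List (E ⊕ E)) (i j : I) (h : Q.double.IsPath i w j) :
    e (Q.contract a ha).double (Q.fuse a ha i) * (w.map (Q.contractArrow a ha)).prod =
      (w.map (Q.contractArrow a ha)).prod * e (Q.contract a ha).double (Q.fuse a ha j) := by
  induction w generalizing i with
  | nil => obtain rfl : i = j := h; simp
  | cons x w ih =>
    obtain ⟨rfl, h⟩ := h
    rw [List.map_cons, List.prod_cons, ← mul_assoc, e_mul_contractArrow, mul_assoc, ih _ h,
      mul_assoc]

theorem contractPath_comp (Q : ArrowQuiver I E) (a : E) (ha : Q.head a ≠ Q.tail a)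
    (p q : Q.double.Path) (h : p.src = q.tgt) :
    Q.contractPath a ha (p.comp q h) = Q.contractPath a ha p * Q.contractPath a ha q := by
  simp only [contractPath, Path.comp, List.map_append, List.prod_append]
  rw [e_mul_contractWord Q a ha p.word p.tgt p.src p.isPath, h]
  rw [mul_assoc _ (e _ _) (e _ _ * _), ← mul_assoc (e _ _) (e _ _), e_mul_e, ← mul_assoc,
    e_mul_contractWord Q a ha p.word p.tgt p.src p.isPath, h, mul_assoc]

theorem grade_mul {Q : ArrowQuiver I E} {r s : ℕ} {x y : Q.double.PathAlgebra}
    (hx : x ∈ Q.grade r) (hy : y ∈ Q.grade s) : x * y ∈ Q.grade (r + s) := by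
  induction hx using Submodule.span_induction with
  | zero => simp
  | add x x' _ _ hx hx' => rw [add_mul]; exact add_mem hx hx'
  | smul c x _ hx => rw [smul_mul_assoc]; exact Submodule.smul_mem _ _ hx
  | mem x hx =>
    obtain ⟨p, rfl, rfl⟩ := hx
    induction hy using Submodule.span_induction with
    | zero => simp
    | add x x' _ _ hx hx' => rw [mul_add]; exact add_mem hx hx'
    | smul c x _ hx => rw [mul_smul_comm]; exact Submodule.smul_mem _ _ hx
    | mem x hx =>
      obtain ⟨q, rfl, rfl⟩ := hx
      by_cases h : p.src = q.tgt
      · rw [of_mul_of_pos p q h]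
        exact Submodule.subset_span ⟨_, numDual_append _ _, rfl⟩
      · rw [of_mul_of_neg p q h]
        exact zero_mem _

theorem e_mem_grade (Q : ArrowQuiver I E) (i : I) : e Q.double i ∈ Q.grade 0 :=
  Submodule.subset_span ⟨_, rfl, rfl⟩

theorem arrow_inl_mem_grade (Q : ArrowQuiver I E) (b : E) :
    arrow Q.double (Sum.inl b) ∈ Q.grade 0 :=
  Submodule.subset_span ⟨_, rfl, rfl⟩

theorem arrow_inr_mem_grade (Q : ArrowQuiver I E) (b : E) :
    arrow Q.double (Sum.inr b) ∈ Q.grade 1 :=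
  Submodule.subset_span ⟨_, rfl, rfl⟩

theorem one_mem_grade (Q : ArrowQuiver I E) : (1 : Q.double.PathAlgebra) ∈ Q.grade 0 := by
  rw [one_def]
  exact sum_mem fun i _ => Q.e_mem_grade i

theorem contractArrow_mem_grade (Q : ArrowQuiver I E) (a : E) (ha : Q.head a ≠ Q.tail a)
    (x : E ⊕ E) : Q.contractArrow a ha x ∈ (Q.contract a ha).grade (numDual [x]) := by
  rcases x with b | b
  · by_cases h : b = a
    · simp only [contractArrow, dif_pos h]; exact one_mem_grade _
    · simp only [contractArrow, dif_neg h]; exact arrow_inl_mem_grade _ _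
  · by_cases h : b = a
    · simp only [contractArrow, dif_pos h]
      refine sub_mem (sum_mem fun c _ => ?_) (sum_mem fun c _ => ?_)
      · exact grade_mul (r := 1) (s := 0) (arrow_inr_mem_grade _ _) (arrow_inl_mem_grade _ _)
      · exact grade_mul (r := 0) (s := 1) (arrow_inl_mem_grade _ _) (arrow_inr_mem_grade _ _)
    · simp only [contractArrow, dif_neg h]; exact arrow_inr_mem_grade _ _

theorem contractPath_mem_grade (Q : ArrowQuiver I E) (a : E) (ha : Q.head a ≠ Q.tail a)
    (p : Q.double.Path) :
    Q.contractPath a ha p ∈ (Q.contract a ha).grade (numDual p.word) := by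
  have key : ∀ w : List (E ⊕ E),
      (w.map (Q.contractArrow a ha)).prod ∈ (Q.contract a ha).grade (numDual w) := by
    intro w
    induction w with
    | nil => exact one_mem_grade _
    | cons x w ih =>
      rw [List.map_cons, List.prod_cons, show numDual (x :: w) = numDual [x] + numDual w from
        numDual_append [x] w]
      exact grade_mul (Q.contractArrow_mem_grade a ha x) ih
  have h := grade_mul ((Q.contract a ha).e_mem_grade (Q.fuse a ha p.tgt)) (key p.word)
  rwa [zero_add] at h

/-- The map `Π ↦ Π_a` from necklaces of `Q` to necklaces of `Q_a`: write `Π` in terms of closed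
paths and substitute. Paths of the double of `Q` that are not closed are zero as necklaces and
have to be sent to zero here, although they may become closed in `Q_a`. -/
def contractNecklace (Q : ArrowQuiver I E) (a : E) (ha : Q.head a ≠ Q.tail a) :
    Q.Necklace →ₗ[ℂ] (Q.contract a ha).Necklace :=
  Q.superCommutators.liftQ
    (lift fun p : Q.double.Path => if p.tgt = p.src then
      (Q.contract a ha).superCommutators.mkQ (Q.contractPath a ha p) else 0)
    (closed_rotation _ fun p q h h' => by
      rw [contractPath_comp, contractPath_comp, ← map_smul, ← sub_eq_zero, ← map_sub]
      refine (Submodule.Quotient.mk_eq_zero _).2 (Submodule.subset_span ?_)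
      exact ⟨_, _, _, Q.contractPath_mem_grade a ha p, _, Q.contractPath_mem_grade a ha q, rfl⟩)

end ArrowQuiver

end

noncomputable section

namespace ArrowQuiver

open PathAlgebra

universe u v

variable {I : Type u} {E : Type v} [Fintype I] [DecidableEq I] [Fintype E] [DecidableEq E]

/-! Well-definedness is built into `contractNecklace`, and degrees are preserved because the
substitute for a* has degree 1. In degree 2 the sign (-1)^(λμ) in D_c equals (-1)^μ, as λ + μ is
even, and the two halves of [P, P] coincide; so P is Poisson exactly when it has degree 2 and Σ_b
D_{b*}(P) D_b(P) vanishes as a necklace. Write M_b, N_b for the images over Q_a of D_b(P),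
D_{b*}(P), put Y = N_a, let A be the element substituted for a*, and j = h(a).

Two facts carry the proof. By the chain rule (`superDeriv_contractNecklace`), since a becomes 1, the
derivatives of P_a differ from M_b and N_b only by the contribution of A: D_b(P_a) = M_b + [t(b) =
j] Y b* + [h(b) = j] b* Y, D_{b*}(P_a) = N_b + [t(b) = j] b Y - [h(b) = j] Y b. The moment map
identity (`sum_superDeriv_mul_arrow`) says Σ_x D_x(P) x = Σ_x ± x D_x(P), with minus for dual
arrows. Its component at j, taken before i and j are fused, yields `contractMap_moment`, which
expresses M_a - Y A through the arrows b ≠ a at j.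

Multiplying out modulo supercommutators (`mkQ_mul_add_commutators`) and using this, Σ_{b≠a}
D_{b*}(P_a) D_b(P_a) becomes Σ_{b≠a} N_b M_b + (M_a - Y A + A Y) Y. Everything has degree 3, so one
of two rotated factors is always even and rotations cost no sign: Y A Y cancels A Y Y, and M_a Y is
N_a M_a. What remains is Σ_b N_b M_b, the contraction of the vanishing sum for P. -/

/-! ### Idempotents, words, signs and degrees -/

theorem e_mul_e_of_ne {Q : ArrowQuiver I E} {i j : I} (h : i ≠ j) : e Q i * e Q j = 0 :=
  (e_mul_of i (Path.triv Q j)).trans (if_neg h)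

theorem of_cons {Q : ArrowQuiver I E} (x : E) (w : List E) (j : I)
    (h : Q.IsPath (Q.tail x) w j) :
    of (⟨Q.head x, x :: w, j, rfl, h⟩ : Q.Path) = arrow Q x * of ⟨Q.tail x, w, j, h⟩ :=
  (of_mul_of_pos (Path.ofArrow Q x) ⟨Q.tail x, w, j, h⟩ rfl).symm

/-- The idempotent matters only for the empty word, whose product is 1 rather than a trivial path.
-/
theorem e_mul_prod {Q : ArrowQuiver I E} {i j : I} {w : List E} (h : Q.IsPath i w j) :
    e Q i * (w.map (arrow Q)).prod = of ⟨i, w, j, h⟩ := by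
  induction w generalizing i with
  | nil =>
    obtain rfl : i = j := h
    simp [e, Path.triv]
  | cons x w ih =>
    obtain ⟨rfl, h⟩ := h
    rw [of_cons x w j h, ← ih h, List.map_cons, List.prod_cons, ← mul_assoc, ← mul_assoc,
      e_mul_arrow x rfl, arrow_mul_e x rfl]

theorem of_mul_e_src {Q : ArrowQuiver I E} (p : Q.Path) : of p * e Q p.src = of p :=
  (of_mul_e _ p).trans (if_pos rfl)

theorem e_tgt_mul_of {Q : ArrowQuiver I E} (p : Q.Path) : e Q p.tgt * of p = of p :=
  (e_mul_of _ p).trans (if_pos rfl)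

/-- The sign of an arrow of the double quiver. -/
def sign (x : E ⊕ E) : ℂ := (-1) ^ numDual [x]

@[simp] theorem sign_inl (b : E) : sign (Sum.inl b) = 1 := by simp [sign, numDual]

@[simp] theorem sign_inr (b : E) : sign (Sum.inr b) = -1 := by simp [sign, numDual]

theorem neg_one_pow_numDual_cons (x : E ⊕ E) (w : List (E ⊕ E)) :
    (-1 : ℂ) ^ numDual (x :: w) = sign x * (-1) ^ numDual w := by
  rw [sign, ← pow_add, ← numDual_append, List.singleton_append]

theorem numDual_cons (x : E ⊕ E) (w : List (E ⊕ E)) :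
    numDual (x :: w) = numDual [x] + numDual w := numDual_append [x] w

theorem arrow_mem_grade (Q : ArrowQuiver I E) (x : E ⊕ E) :
    arrow Q.double x ∈ Q.grade (numDual [x]) :=
  Submodule.subset_span ⟨_, rfl, rfl⟩

theorem of_mem_grade (Q : ArrowQuiver I E) (p : Q.double.Path) :
    of p ∈ Q.grade (numDual p.word) :=
  Submodule.subset_span ⟨_, rfl, rfl⟩

theorem prod_mem_grade (Q : ArrowQuiver I E) (w : List (E ⊕ E)) :
    (w.map (arrow Q.double)).prod ∈ Q.grade (numDual w) := by
  induction w with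
  | nil => exact one_mem_grade _
  | cons x w ih =>
    rw [List.map_cons, List.prod_cons, numDual_cons]
    exact grade_mul (Q.arrow_mem_grade x) ih

/-! ### Derivatives with a slot, and the cyclic Leibniz rule -/

/-- For a word `x₁ ⋯ xₙ`, the linear map
`z ↦ ∑ (-1)^(μₖ) xₖ₊₁ ⋯ xₙ z x₁ ⋯ xₖ₋₁`, the sum being over the positions `k` with `xₖ = c`, where
`μₖ` is the number of dual arrows among `x₁, …, xₖ`. -/
def wordSlide (Q : ArrowQuiver I E) (c : E ⊕ E) :
    List (E ⊕ E) → Q.double.PathAlgebra →ₗ[ℂ] Q.double.PathAlgebra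
  | [] => 0
  | x :: w => (if x = c then sign c • (LinearMap.mulRight ℂ (e Q.double (Q.double.head c)) ∘ₗ
      LinearMap.mulLeft ℂ (e Q.double (Q.double.tail c) * (w.map (arrow Q.double)).prod)) else 0) +
      sign x • (wordSlide Q c w ∘ₗ LinearMap.mulRight ℂ (arrow Q.double x))

theorem wordSlide_nil (Q : ArrowQuiver I E) (c : E ⊕ E) (z : Q.double.PathAlgebra) :
    Q.wordSlide c [] z = 0 := rfl

theorem wordSlide_cons (Q : ArrowQuiver I E) (c x : E ⊕ E) (w : List (E ⊕ E))
    (z : Q.double.PathAlgebra) :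
    Q.wordSlide c (x :: w) z = (if x = c then sign c • (e Q.double (Q.double.tail c) *
      (w.map (arrow Q.double)).prod * z * e Q.double (Q.double.head c)) else 0) +
      sign x • Q.wordSlide c w (z * arrow Q.double x) := by
  rw [wordSlide]
  split_ifs <;> simp [mul_assoc]

/-- The bilinear extension of `wordSlide` to the path algebra. -/
def slide (Q : ArrowQuiver I E) (c : E ⊕ E) :
    Q.double.PathAlgebra →ₗ[ℂ] Q.double.PathAlgebra →ₗ[ℂ] Q.double.PathAlgebra :=
  lift fun p => Q.wordSlide c p.word

theorem slide_of (Q : ArrowQuiver I E) (c : E ⊕ E) (p : Q.double.Path) :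
    Q.slide c (of p) = Q.wordSlide c p.word := lift_of _ _

@[simp] theorem slide_e (Q : ArrowQuiver I E) (c : E ⊕ E) (i : I) :
    Q.slide c (e Q.double i) = 0 := Q.slide_of c _

@[simp] theorem slide_one (Q : ArrowQuiver I E) (c : E ⊕ E) : Q.slide c 1 = 0 := by
  simp [one_def]

theorem slide_arrow (Q : ArrowQuiver I E) (c x : E ⊕ E) (z : Q.double.PathAlgebra) :
    Q.slide c (arrow Q.double x) z = if x = c then sign c • (e Q.double (Q.double.tail c) *
      z * e Q.double (Q.double.head c)) else 0 := by
  rw [arrow, slide_of, Path.ofArrow, wordSlide_cons, wordSlide_nil]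
  simp

theorem wordSlide_mul_e (Q : ArrowQuiver I E) (c : E ⊕ E) {i j : I} {w : List (E ⊕ E)}
    (h : Q.double.IsPath i w j) (k : I) (z : Q.double.PathAlgebra) :
    Q.wordSlide c w (z * e Q.double k) = if k = i then Q.wordSlide c w z else 0 := by
  cases w with
  | nil => simp [wordSlide_nil]
  | cons x w =>
    obtain ⟨rfl, h⟩ := h
    simp only [wordSlide_cons, mul_assoc z]
    by_cases hk : k = Q.double.head x
    · rw [if_pos hk, e_mul_arrow x hk]
      congr 1
      refine ite_congr rfl (fun hx => ?_) fun _ => rfl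
      subst hx
      rw [hk]
      simp only [mul_assoc, e_mul_e]
    · have h0 : e Q.double k * arrow Q.double x = 0 :=
        (e_mul_of k (Path.ofArrow Q.double x)).trans (if_neg hk)
      rw [if_neg hk, h0, mul_zero, map_zero, smul_zero, add_zero]
      refine ite_eq_right_iff.2 fun hx => ?_
      subst hx
      rw [mul_assoc, mul_assoc, mul_assoc, e_mul_e_of_ne hk]
      simp

/-- This is the Leibniz rule for a trivial path, which has degree 0 and no derivative. -/
theorem slide_e_mul (Q : ArrowQuiver I E) (c : E ⊕ E) (i : I) (y z : Q.double.PathAlgebra) :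
    Q.slide c (e Q.double i * y) z = Q.slide c y (z * e Q.double i) := by
  induction y using PathAlgebra.induction with
  | h0 => simp
  | hadd a b ha hb => simp [mul_add, ha, hb]
  | hof t q =>
    rw [mul_smul_comm, map_smul, map_smul, LinearMap.smul_apply, LinearMap.smul_apply, e_mul_of,
      slide_of, Q.wordSlide_mul_e c q.isPath]
    split_ifs <;> simp [slide_of]

theorem slide_arrow_mul (Q : ArrowQuiver I E) (c x : E ⊕ E) (y z : Q.double.PathAlgebra) :
    Q.slide c (arrow Q.double x * y) z =
      Q.slide c (arrow Q.double x) (y * z) + sign x • Q.slide c y (z * arrow Q.double x) := by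
  induction y using PathAlgebra.induction with
  | h0 => simp
  | hadd a b ha hb =>
    simp only [mul_add, add_mul, map_add, LinearMap.add_apply, ha, hb, smul_add]; abel
  | hof t q =>
    obtain ⟨i, w, j, h⟩ := q
    simp only [mul_smul_comm, smul_mul_assoc, map_smul, LinearMap.smul_apply, smul_comm (sign x) t,
      ← smul_add]
    congr 1
    by_cases hi : Q.double.tail x = i
    · subst hi
      rw [← of_cons x w j h, slide_of, slide_of, wordSlide_cons, slide_arrow, ← e_mul_prod h]
      split_ifs with hx
      · subst hx
        simp only [← mul_assoc, e_mul_e]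
      · rfl
    -- If the arrow and the path do not concatenate, the left side is zero and both terms on the
    -- right vanish separately: the second ends its slot in the wrong idempotent, the first contains
    -- a zero product.
    · have h0 : arrow Q.double x * of (⟨i, w, j, h⟩ : Q.double.Path) = 0 :=
        of_mul_of_neg _ _ hi
      rw [h0, ← arrow_mul_e x rfl, ← mul_assoc z, slide_of, Q.wordSlide_mul_e c h, if_neg hi,
        arrow_mul_e x rfl, slide_arrow]
      refine .symm ?_
      simp only [smul_zero, add_zero, map_zero, LinearMap.zero_apply]
      refine ite_eq_right_iff.2 fun hx => ?_
      subst hx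
      rw [← mul_assoc, e_mul_of, if_neg hi]
      simp

theorem slide_of_mul (Q : ArrowQuiver I E) (c : E ⊕ E) {i j : I} {w : List (E ⊕ E)}
    (h : Q.double.IsPath i w j) (y z : Q.double.PathAlgebra) :
    Q.slide c (of ⟨i, w, j, h⟩ * y) z = Q.slide c (of ⟨i, w, j, h⟩) (y * z) +
      (-1 : ℂ) ^ numDual w • Q.slide c y (z * of ⟨i, w, j, h⟩) := by
  induction w generalizing i y z with
  | nil =>
    have hij : i = j := h
    subst hij
    have : of (⟨i, [], i, h⟩ : Q.double.Path) = e Q.double i := rfl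
    rw [this, slide_e_mul]
    simp [numDual]
  | cons x w ih =>
    obtain ⟨rfl, h⟩ := h
    rw [of_cons x w j h, mul_assoc, slide_arrow_mul, slide_arrow_mul, ih h,
      neg_one_pow_numDual_cons, smul_add, smul_smul, mul_assoc, mul_assoc, mul_assoc, add_assoc]

/-- Cyclic Leibniz rule. An occurrence of `c` in `x` sees `y` in front of the slot; one in `y` sees
`x` behind it, and the sign `(-1)^r` arises because `μₖ` then also counts the dual arrows of `x`.
Unlike `superDeriv`, which lives on necklaces, `slide` can thus be computed factor by factor. -/
theorem slide_mul (Q : ArrowQuiver I E) (c : E ⊕ E) {r : ℕ} {x : Q.double.PathAlgebra}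
    (hx : x ∈ Q.grade r) (y z : Q.double.PathAlgebra) :
    Q.slide c (x * y) z = Q.slide c x (y * z) + (-1 : ℂ) ^ r • Q.slide c y (z * x) := by
  induction hx using Submodule.span_induction generalizing y z with
  | zero => simp
  | add x x' _ _ hx hx' =>
    simp only [mul_add, add_mul, map_add, LinearMap.add_apply, hx, hx', smul_add]; abel
  | smul t x _ hx =>
    simp only [smul_mul_assoc, mul_smul_comm, map_smul, LinearMap.smul_apply, hx, smul_add,
      smul_comm t]
  | mem x hx =>
    obtain ⟨p, rfl, rfl⟩ := hx
    exact Q.slide_of_mul c p.isPath y z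

/-! ### Comparison with `D_c` in even degree -/

theorem wordSlide_eq_sum (Q : ArrowQuiver I E) (c : E ⊕ E) (w : List (E ⊕ E))
    (z : Q.double.PathAlgebra) :
    Q.wordSlide c w z = ∑ k ∈ Finset.range w.length, if w[k]? = some c then
      (-1 : ℂ) ^ numDual (w.take (k + 1)) •
        (e Q.double (Q.double.tail c) * ((w.drop (k + 1)).map (arrow Q.double)).prod * z *
          ((w.take k).map (arrow Q.double)).prod * e Q.double (Q.double.head c))
      else 0 := by
  induction w generalizing z with
  | nil => rfl
  | cons x w ih =>
    rw [wordSlide_cons, List.length_cons, Finset.sum_range_succ', ih, add_comm, Finset.smul_sum]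
    congr 1
    · refine Finset.sum_congr rfl fun k _ => ?_
      simp only [List.getElem?_cons_succ, List.take_succ_cons, List.drop_succ_cons, List.map_cons,
        List.prod_cons, neg_one_pow_numDual_cons]
      split_ifs
      · rw [smul_smul]; simp only [mul_assoc]
      · simp
    · simp only [List.getElem?_cons_zero, Option.some.injEq]
      split_ifs with hx
      · subst hx; simp [sign]
      · rfl

theorem IsPath.split {Q : ArrowQuiver I E} {i j : I} {w : List E} (h : Q.IsPath i w j) {k : ℕ}
    {c : E} (hk : w[k]? = some c) :
    Q.IsPath i (w.take k) (Q.head c) ∧ Q.IsPath (Q.tail c) (w.drop (k + 1)) j := by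
  induction w generalizing i k with
  | nil => simp at hk
  | cons x w ih =>
    cases k with
    | zero =>
      obtain rfl : x = c := by simpa using hk
      exact ⟨h.1, h.2⟩
    | succ k =>
      have := ih h.2 (k := k) (by simpa using hk)
      exact ⟨⟨h.1, this.1⟩, this.2⟩

theorem prod_mul_e {Q : ArrowQuiver I E} {i j : I} {w : List E} (h : Q.IsPath i w j) :
    e Q i * (w.map (arrow Q)).prod = e Q i * (w.map (arrow Q)).prod * e Q j := by
  rw [e_mul_prod h]
  exact (of_mul_e_src _).symm

theorem prod_mul_e' {Q : ArrowQuiver I E} {i j : I} {w : List E} (h : Q.IsPath i w j) :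
    (w.map (arrow Q)).prod * e Q j = e Q i * (w.map (arrow Q)).prod * e Q j := by
  induction w generalizing i with
  | nil =>
    obtain rfl : i = j := h
    simp [e_mul_e]
  | cons x w ih =>
    obtain ⟨rfl, h⟩ := h
    rw [List.map_cons, List.prod_cons, ← mul_assoc, e_mul_arrow x rfl]

/-- With an even total number of dual arrows, `λₖ` and `μₖ` have the same parity, so `(-1)^(λₖ μₖ) =
(-1)^(μₖ)`. No closedness test is needed on the right: putting 1 in the slot joins the two ends of
the path, which gives zero unless they agree. -/
theorem superDeriv_of (Q : ArrowQuiver I E) (c : E ⊕ E) (p : Q.double.Path)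
    (hp : Even (numDual p.word)) :
    Q.superDeriv c (Q.superCommutators.mkQ (of p)) = Q.slide c (of p) 1 := by
  have h1 : Q.superDeriv c (Q.superCommutators.mkQ (of p)) =
      if p.tgt = p.src then Q.wordDeriv c p.word else 0 := by
    rw [superDeriv, Submodule.mkQ_apply, Submodule.liftQ_apply, lift_of]
  rw [h1, slide_of, wordSlide_eq_sum, wordDeriv]
  have key : ∀ k, (p.word[k]? = some c) →
      e Q.double (Q.double.tail c) * ((p.word.drop (k + 1)).map (arrow Q.double)).prod * 1 *
          ((p.word.take k).map (arrow Q.double)).prod * e Q.double (Q.double.head c) =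
      if p.tgt = p.src then e Q.double (Q.double.tail c) *
        ((p.word.drop (k + 1) ++ p.word.take k).map (arrow Q.double)).prod else 0 := by
    intro k hk
    obtain ⟨hu, hv⟩ := p.isPath.split hk
    rw [mul_one, mul_assoc, prod_mul_e hv, prod_mul_e' hu]
    split_ifs with h
    · rw [List.map_append, List.prod_append, ← mul_assoc (e _ _), prod_mul_e hv, ← h,
        ← prod_mul_e hu]
      simp only [mul_assoc]
      simp only [← mul_assoc (e _ p.tgt) (e _ p.tgt), e_mul_e]
    · simp only [mul_assoc]
      rw [← mul_assoc (e _ p.src), e_mul_e_of_ne (Ne.symm h)]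
      simp
  -- This is where evenness of the degree enters.
  have hsign : ∀ k, (-1 : ℂ) ^ (numDual (p.word.drop (k + 1)) * numDual (p.word.take (k + 1))) =
      (-1) ^ numDual (p.word.take (k + 1)) := by
    intro k
    have h := hp
    rw [← List.take_append_drop (k + 1) p.word, numDual_append, Nat.even_add] at h
    refine neg_one_pow_congr ?_
    rw [Nat.even_mul, h]
    tauto
  split_ifs with h
  · refine Finset.sum_congr rfl fun k _ => ?_
    split_ifs with hk
    · rw [hsign, key k hk, if_pos h]
    · rfl
  · refine (Finset.sum_eq_zero fun k _ => ?_).symm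
    split_ifs with hk
    · rw [key k hk, if_neg h, smul_zero]
    · rfl

theorem superDeriv_mkQ (Q : ArrowQuiver I E) (c : E ⊕ E) {r : ℕ} (hr : Even r)
    {x : Q.double.PathAlgebra} (hx : x ∈ Q.grade r) :
    Q.superDeriv c (Q.superCommutators.mkQ x) = Q.slide c x 1 := by
  induction hx using Submodule.span_induction with
  | zero => simp
  | add x y _ _ hx hy => simp only [map_add, LinearMap.add_apply, hx, hy]
  | smul t x _ hx => simp only [map_smul, LinearMap.smul_apply, hx]
  | mem x hx =>
    obtain ⟨p, rfl, rfl⟩ := hx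
    exact Q.superDeriv_of c p hr

/-! ### Even necklaces, their derivatives and the moment map identity -/

/-- The sum telescopes: position `k` contributes `(-1)^(μₖ) xₖ₊₁ ⋯ xₙ z x₁ ⋯ xₖ` minus the same
expression for `k - 1`, and only the extreme terms survive. The slot `z` is arbitrary because the
induction on the word absorbs the first arrow into it. -/
theorem sum_wordSlide (Q : ArrowQuiver I E) {i j : I} {w : List (E ⊕ E)}
    (h : Q.double.IsPath i w j) (z : Q.double.PathAlgebra) :
    ∑ x, Q.wordSlide x w (e Q.double j * z * e Q.double i) * arrow Q.double x -
      ∑ x, sign x • (arrow Q.double x * Q.wordSlide x w (e Q.double j * z * e Q.double i)) =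
    (-1 : ℂ) ^ numDual w • (e Q.double j * z * of ⟨i, w, j, h⟩) -
      of ⟨i, w, j, h⟩ * z * e Q.double i := by
  induction w generalizing i z with
  | nil =>
    have hij : i = j := h
    subst hij
    have : of (⟨i, [], i, h⟩ : Q.double.Path) = e Q.double i := rfl
    simp [wordSlide_nil, this, numDual]
  | cons x w ih =>
    obtain ⟨rfl, h⟩ := h
    have ih := ih h (z * arrow Q.double x)
    rw [← mul_assoc, mul_assoc _ _ (e _ _), arrow_mul_e x rfl] at ih
    have hs : sign x * sign x = 1 := by cases x <;> simp
    have h1 : e Q.double j * z * e Q.double (Q.double.head x) * arrow Q.double x =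
      e Q.double j * z * arrow Q.double x := by rw [mul_assoc, e_mul_arrow x rfl]
    simp only [wordSlide_cons, add_mul, mul_add, smul_add, Finset.sum_add_distrib, h1,
      ite_mul, mul_ite, smul_ite, zero_mul, mul_zero, smul_zero, Finset.sum_ite_eq,
      Finset.mem_univ, if_true, smul_mul_assoc, mul_smul_comm, smul_smul, hs, one_smul]
    have h2 : ∀ f : E ⊕ E → Q.double.PathAlgebra,
        ∑ y, (sign y * sign x) • f y = sign x • ∑ y, sign y • f y := fun f => by
      simp only [Finset.smul_sum, smul_smul, mul_comm]
    rw [h2, ← Finset.smul_sum, add_sub_add_comm, ← smul_sub, ih, of_cons x w j h,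
      neg_one_pow_numDual_cons, smul_sub, smul_smul, ← e_mul_prod h]
    have h3 : ∀ y, e Q.double (Q.double.tail x) * ((w.map (arrow Q.double)).prod *
        (e Q.double j * y)) = e Q.double (Q.double.tail x) * ((w.map (arrow Q.double)).prod * y) :=
      fun y => by simp only [← mul_assoc, ← prod_mul_e h]
    simp only [mul_assoc, h3, e_mul_e, e_mul_arrow x rfl, arrow_mul_e x rfl]
    abel

theorem mkQ_mul_comm (Q : ArrowQuiver I E) {p r : ℕ} {x y : Q.double.PathAlgebra}
    (hx : x ∈ Q.grade p) (hy : y ∈ Q.grade r) (h : Even (p * r)) :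
    Q.superCommutators.mkQ (x * y) = Q.superCommutators.mkQ (y * x) := by
  rw [← sub_eq_zero, ← map_sub]
  refine (Submodule.Quotient.mk_eq_zero _).2 (Submodule.subset_span ⟨p, r, x, hx, y, hy, ?_⟩)
  rw [h.neg_one_pow, one_smul]

/-- Write the path as `p e` with `e` the idempotent at its source; `e` has degree 0, so it rotates
to the front, where it kills `p`. -/
theorem mkQ_of_eq_zero (Q : ArrowQuiver I E) (p : Q.double.Path) (h : p.tgt ≠ p.src) :
    Q.superCommutators.mkQ (of p) = 0 := by
  rw [← of_mul_e_src p, Q.mkQ_mul_comm (of_mem_grade Q p) (Q.e_mem_grade _) (by simp), e_mul_of,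
    if_neg h.symm, map_zero]

/-- Necklaces of degree `r` are linear combinations of closed paths of degree `r`. -/
theorem necklaceGrade_induction {Q : ArrowQuiver I E} {r : ℕ} {p : Q.Necklace → Prop}
    (h0 : p 0) (hadd : ∀ x y, p x → p y → p (x + y)) (hsmul : ∀ (t : ℂ) x, p x → p (t • x))
    (hof : ∀ (i : I) (w : List (E ⊕ E)) (h : Q.double.IsPath i w i), numDual w = r →
      p (Q.superCommutators.mkQ (of ⟨i, w, i, h⟩)))
    {P : Q.Necklace} (hP : P ∈ Q.necklaceGrade r) : p P := by
  obtain ⟨x, hx, rfl⟩ := hP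
  induction hx using Submodule.span_induction with
  | zero => rw [map_zero]; exact h0
  | add x y _ _ hx hy => rw [map_add]; exact hadd _ _ hx hy
  | smul t x _ hx => rw [map_smul]; exact hsmul _ _ hx
  | mem x hx =>
    obtain ⟨q, hq, rfl⟩ := hx
    by_cases h : q.tgt = q.src
    · obtain ⟨i, w, j, hw⟩ := q
      obtain rfl : i = j := h
      exact hof i w hw hq
    · rw [Q.mkQ_of_eq_zero q h]; exact h0

/-- The degree condition is additive so as to avoid subtraction of natural numbers: `c` is removed
and `z` inserted. -/
theorem wordSlide_mem_grade (Q : ArrowQuiver I E) (c : E ⊕ E) {w : List (E ⊕ E)} {r s : ℕ}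
    {z : Q.double.PathAlgebra} (hz : z ∈ Q.grade s) (h : r + numDual [c] = numDual w + s) :
    Q.wordSlide c w z ∈ Q.grade r := by
  induction w generalizing z s with
  | nil => rw [wordSlide_nil]; exact zero_mem _
  | cons x w ih =>
    rw [wordSlide_cons]
    rw [numDual_cons x w] at h
    refine add_mem ?_ (Submodule.smul_mem _ _ (ih (grade_mul hz (Q.arrow_mem_grade x)) (by omega)))
    split_ifs with hx
    · subst hx
      refine Submodule.smul_mem _ _ ?_
      have := grade_mul (grade_mul (grade_mul (Q.e_mem_grade (Q.double.tail x))
        (Q.prod_mem_grade w)) hz) (Q.e_mem_grade (Q.double.head x))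
      rwa [show 0 + numDual w + s + 0 = r by omega] at this
    · exact zero_mem _

theorem e_mul_wordSlide (Q : ArrowQuiver I E) (c : E ⊕ E) (w : List (E ⊕ E))
    (z : Q.double.PathAlgebra) :
    e Q.double (Q.double.tail c) * Q.wordSlide c w z = Q.wordSlide c w z := by
  induction w generalizing z with
  | nil => simp [wordSlide_nil]
  | cons x w ih =>
    rw [wordSlide_cons, mul_add, mul_smul_comm, ih, mul_ite, mul_zero, mul_smul_comm]
    simp only [← mul_assoc, e_mul_e]

theorem wordSlide_mul_e_head (Q : ArrowQuiver I E) (c : E ⊕ E) (w : List (E ⊕ E))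
    (z : Q.double.PathAlgebra) :
    Q.wordSlide c w z * e Q.double (Q.double.head c) = Q.wordSlide c w z := by
  induction w generalizing z with
  | nil => simp [wordSlide_nil]
  | cons x w ih =>
    rw [wordSlide_cons, add_mul, smul_mul_assoc, ih, ite_mul, zero_mul, smul_mul_assoc]
    simp only [mul_assoc, e_mul_e]

/-- Replacing the slot 1 by `e i` gives it definite end points, as the telescoping identity and the
chain rule for words require. -/
theorem superDeriv_mkQ_of (Q : ArrowQuiver I E) (c : E ⊕ E) {i : I} {w : List (E ⊕ E)}
    (h : Q.double.IsPath i w i) (hw : Even (numDual w)) :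
    Q.superDeriv c (Q.superCommutators.mkQ (of ⟨i, w, i, h⟩)) =
      Q.wordSlide c w (e Q.double i) := by
  rw [Q.superDeriv_of c _ hw, slide_of, ← one_mul (e Q.double i), Q.wordSlide_mul_e c h, if_pos rfl]

theorem superDeriv_mem_grade (Q : ArrowQuiver I E) (c : E ⊕ E) {r s : ℕ} (hr : Even r)
    (hs : s + numDual [c] = r) {P : Q.Necklace} (hP : P ∈ Q.necklaceGrade r) :
    Q.superDeriv c P ∈ Q.grade s := by
  refine necklaceGrade_induction (p := fun P => Q.superDeriv c P ∈ Q.grade s) ?_ ?_ ?_ ?_ hP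
  · rw [map_zero]; exact zero_mem _
  · intro x y hx hy; rw [map_add]; exact add_mem hx hy
  · intro t x hx; rw [map_smul]; exact Submodule.smul_mem _ _ hx
  · intro i w h hw
    rw [Q.superDeriv_mkQ_of c h (hw ▸ hr)]
    exact Q.wordSlide_mem_grade c (Q.e_mem_grade i) (by omega)

/-- Together with `superDeriv_mul_e`: `D_c` of a necklace runs opposite to `c`. Hence its products
with `c`, and those of `D_{b*}` with `D_b`, are genuine concatenations, which substitution respects.
-/
theorem e_mul_superDeriv (Q : ArrowQuiver I E) (c : E ⊕ E) {r : ℕ} (hr : Even r)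
    {P : Q.Necklace} (hP : P ∈ Q.necklaceGrade r) :
    e Q.double (Q.double.tail c) * Q.superDeriv c P = Q.superDeriv c P := by
  refine necklaceGrade_induction
    (p := fun P => e Q.double (Q.double.tail c) * Q.superDeriv c P = Q.superDeriv c P)
    ?_ ?_ ?_ ?_ hP
  · simp
  · intro x y hx hy; rw [map_add, mul_add, hx, hy]
  · intro t x hx; rw [map_smul, mul_smul_comm, hx]
  · intro i w h hw
    rw [Q.superDeriv_mkQ_of c h (hw ▸ hr), e_mul_wordSlide]

theorem superDeriv_mul_e (Q : ArrowQuiver I E) (c : E ⊕ E) {r : ℕ} (hr : Even r)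
    {P : Q.Necklace} (hP : P ∈ Q.necklaceGrade r) :
    Q.superDeriv c P * e Q.double (Q.double.head c) = Q.superDeriv c P := by
  refine necklaceGrade_induction
    (p := fun P => Q.superDeriv c P * e Q.double (Q.double.head c) = Q.superDeriv c P)
    ?_ ?_ ?_ ?_ hP
  · simp
  · intro x y hx hy; rw [map_add, add_mul, hx, hy]
  · intro t x hx; rw [map_smul, smul_mul_assoc, hx]
  · intro i w h hw
    rw [Q.superDeriv_mkQ_of c h (hw ▸ hr), wordSlide_mul_e_head]

/-- The moment map identity. -/
theorem sum_superDeriv_mul_arrow (Q : ArrowQuiver I E) {r : ℕ} (hr : Even r)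
    {P : Q.Necklace} (hP : P ∈ Q.necklaceGrade r) :
    ∑ x, Q.superDeriv x P * arrow Q.double x =
      ∑ x, sign x • (arrow Q.double x * Q.superDeriv x P) := by
  refine necklaceGrade_induction (p := fun P => ∑ x, Q.superDeriv x P * arrow Q.double x =
      ∑ x, sign x • (arrow Q.double x * Q.superDeriv x P)) ?_ ?_ ?_ ?_ hP
  · simp
  · intro x y hx hy
    simp only [map_add, add_mul, mul_add, smul_add, Finset.sum_add_distrib, hx, hy]
  · intro t x hx
    simp only [map_smul, smul_mul_assoc, mul_smul_comm, smul_comm _ t, ← Finset.smul_sum, hx]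
  · intro i w h hw
    have key := Q.sum_wordSlide h (e Q.double i)
    have h1 : e Q.double i * of (⟨i, w, i, h⟩ : Q.double.Path) = of ⟨i, w, i, h⟩ :=
      e_tgt_mul_of (⟨i, w, i, h⟩ : Q.double.Path)
    have h2 : of (⟨i, w, i, h⟩ : Q.double.Path) * e Q.double i = of ⟨i, w, i, h⟩ :=
      of_mul_e_src (⟨i, w, i, h⟩ : Q.double.Path)
    -- For a closed word of even degree and `z = e i`, both extreme terms of the telescope are the
    -- word itself, so they cancel.
    simp only [e_mul_e, h1, h2, hw, hr.neg_one_pow, one_smul, sub_self] at key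
    simp only [fun c => Q.superDeriv_mkQ_of c h (hw ▸ hr)]
    exact sub_eq_zero.1 key

/-! ### The bracket of a bivector with itself -/

/-- For `r = s = 2` the sign `(-1)^((r-1)(s-1))` is -1, so the two halves of the bracket add up. -/
theorem schouten_two_two_self (Q : ArrowQuiver I E) (P : Q.Necklace) :
    Q.schouten 2 2 P P = (2 : ℂ) • Q.superCommutators.mkQ
      (∑ b : E, Q.superDeriv (Sum.inr b) P * Q.superDeriv (Sum.inl b) P) := by
  rw [schouten, ← map_smul, Finset.smul_sum]
  congr 1
  refine Finset.sum_congr rfl fun b _ => ?_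
  norm_num
  rw [two_smul]

theorem isPoisson_iff (Q : ArrowQuiver I E) (P : Q.Necklace) :
    Q.IsPoisson P ↔ P ∈ Q.necklaceGrade 2 ∧ Q.superCommutators.mkQ
      (∑ b : E, Q.superDeriv (Sum.inr b) P * Q.superDeriv (Sum.inl b) P) = 0 := by
  rw [IsPoisson, schouten_two_two_self, smul_eq_zero]
  simp

/-! ### Substitution on the path algebra -/

/-- The linear extension of `contractPath` to the path algebra. It is multiplicative only on
elements that can be concatenated. -/
def contractMap (Q : ArrowQuiver I E) (a : E) (ha : Q.head a ≠ Q.tail a) :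
    Q.double.PathAlgebra →ₗ[ℂ] (Q.contract a ha).double.PathAlgebra :=
  lift (Q.contractPath a ha)

section

variable (Q : ArrowQuiver I E) (a : E) (ha : Q.head a ≠ Q.tail a)

theorem contractMap_of (p : Q.double.Path) :
    Q.contractMap a ha (of p) = Q.contractPath a ha p := lift_of _ _

theorem contractMap_arrow (x : E ⊕ E) :
    Q.contractMap a ha (arrow Q.double x) =
      e (Q.contract a ha).double (Q.fuse a ha (Q.double.head x)) * Q.contractArrow a ha x := by
  rw [arrow, contractMap_of, contractPath, Path.ofArrow]
  simp

theorem contractMap_e (i : I) :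
    Q.contractMap a ha (e Q.double i) = e (Q.contract a ha).double (Q.fuse a ha i) := by
  rw [e, contractMap_of, contractPath, Path.triv]
  simp

theorem contractMap_mul_e_mul (i : I) (x y : Q.double.PathAlgebra) :
    Q.contractMap a ha (x * e Q.double i * (e Q.double i * y)) =
      Q.contractMap a ha (x * e Q.double i) * Q.contractMap a ha (e Q.double i * y) := by
  induction x using PathAlgebra.induction with
  | h0 => simp
  | hadd x x' hx hx' => simp only [add_mul, map_add, hx, hx']
  | hof s p =>
    induction y using PathAlgebra.induction with
    | h0 => simp
    | hadd y y' hy hy' => simp only [mul_add, map_add, hy, hy']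
    | hof t q =>
      simp only [smul_mul_assoc, mul_smul_comm, map_smul]
      rw [of_mul_e, e_mul_of]
      split_ifs with h h'
      · rw [of_mul_of_pos p q (h.trans h'), contractMap_of, contractMap_of, contractMap_of,
          contractPath_comp]
      all_goals simp

/-- The hypotheses force both factors to meet at one vertex of `Q`. Otherwise a path ending at one
end of `a` times a path starting at the other is zero before fusing, while the product of the images
may be nonzero. -/
theorem contractMap_mul {i : I} {x y : Q.double.PathAlgebra} (hx : x * e Q.double i = x)
    (hy : e Q.double i * y = y) :
    Q.contractMap a ha (x * y) = Q.contractMap a ha x * Q.contractMap a ha y := by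
  have h := Q.contractMap_mul_e_mul a ha i x y
  rwa [hx, hy] at h

theorem e_mul_contractMap {i : I} {x : Q.double.PathAlgebra} (hx : e Q.double i * x = x) :
    e (Q.contract a ha).double (Q.fuse a ha i) * Q.contractMap a ha x = Q.contractMap a ha x := by
  rw [← contractMap_e, ← Q.contractMap_mul a ha (e_mul_e i) hx, hx]

theorem contractMap_mul_e {i : I} {x : Q.double.PathAlgebra} (hx : x * e Q.double i = x) :
    Q.contractMap a ha x * e (Q.contract a ha).double (Q.fuse a ha i) = Q.contractMap a ha x := by
  rw [← contractMap_e, ← Q.contractMap_mul a ha hx (e_mul_e i), hx]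

theorem contractMap_mem_grade {r : ℕ} {x : Q.double.PathAlgebra} (hx : x ∈ Q.grade r) :
    Q.contractMap a ha x ∈ (Q.contract a ha).grade r := by
  suffices h : Q.grade r ≤ ((Q.contract a ha).grade r).comap (Q.contractMap a ha) from h hx
  refine Submodule.span_le.2 ?_
  rintro _ ⟨p, rfl, rfl⟩
  rw [SetLike.mem_coe, Submodule.mem_comap, contractMap_of]
  exact Q.contractPath_mem_grade a ha p

theorem contractNecklace_mkQ_of {i : I} {w : List (E ⊕ E)} (h : Q.double.IsPath i w i) :
    Q.contractNecklace a ha (Q.superCommutators.mkQ (of ⟨i, w, i, h⟩)) =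
      (Q.contract a ha).superCommutators.mkQ (Q.contractPath a ha ⟨i, w, i, h⟩) := by
  rw [contractNecklace, Submodule.mkQ_apply, Submodule.liftQ_apply, lift_of, if_pos rfl]

/-- The hypotheses restrict `x` to closed paths at `i`: a path between the two ends of `a` is zero
as a necklace of `Q`, but its substitution may be closed and nonzero over the contracted quiver. -/
theorem contractNecklace_mkQ {i : I} {x : Q.double.PathAlgebra} (hx : e Q.double i * x = x)
    (hx' : x * e Q.double i = x) :
    Q.contractNecklace a ha (Q.superCommutators.mkQ x) =
      (Q.contract a ha).superCommutators.mkQ (Q.contractMap a ha x) := by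
  have key : ∀ y, Q.contractNecklace a ha
      (Q.superCommutators.mkQ (e Q.double i * y * e Q.double i)) =
      (Q.contract a ha).superCommutators.mkQ
        (Q.contractMap a ha (e Q.double i * y * e Q.double i)) := by
    intro y
    induction y using PathAlgebra.induction with
    | h0 => simp
    | hadd x y hx hy => simp only [mul_add, add_mul, map_add, hx, hy]
    | hof t p =>
      simp only [smul_mul_assoc, mul_smul_comm, map_smul]
      rw [e_mul_of]
      split_ifs with h
      · rw [of_mul_e]
        split_ifs with h'
        · obtain ⟨i', w, j, hw⟩ := p
          obtain rfl : i = i' := h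
          have hj : j = i := h'
          subst hj
          rw [contractNecklace_mkQ_of, contractMap_of]
        · simp
      · simp
  have := key x
  rwa [hx, hx'] at this

theorem contractNecklace_mem_necklaceGrade {r : ℕ} {P : Q.Necklace} (hP : P ∈ Q.necklaceGrade r) :
    Q.contractNecklace a ha P ∈ (Q.contract a ha).necklaceGrade r := by
  refine necklaceGrade_induction
    (p := fun P => Q.contractNecklace a ha P ∈ (Q.contract a ha).necklaceGrade r) ?_ ?_ ?_ ?_ hP
  · rw [map_zero]; exact zero_mem _
  · intro x y hx hy; rw [map_add]; exact add_mem hx hy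
  · intro t x hx; rw [map_smul]; exact Submodule.smul_mem _ _ hx
  · intro i w h hw
    rw [contractNecklace_mkQ_of]
    exact Submodule.mem_map_of_mem (hw ▸ Q.contractPath_mem_grade a ha ⟨i, w, i, h⟩)

/-! ### The chain rule -/

theorem contractArrow_inl (b : {b : E // b ≠ a}) :
    Q.contractArrow a ha (Sum.inl b) = arrow (Q.contract a ha).double (Sum.inl b) := by
  rw [contractArrow, dif_neg b.2]

theorem contractArrow_inr (b : {b : E // b ≠ a}) :
    Q.contractArrow a ha (Sum.inr b) = arrow (Q.contract a ha).double (Sum.inr b) := by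
  rw [contractArrow, dif_neg b.2]

theorem contractArrow_inl_self : Q.contractArrow a ha (Sum.inl a) = 1 := by
  rw [contractArrow, dif_pos rfl]

theorem contractArrow_inr_self :
    Q.contractArrow a ha (Sum.inr a) =
      ∑ b : {b : E // b ≠ a},
        ((if Q.tail b = Q.head a then arrow (Q.contract a ha).double (Sum.inr b) *
            arrow (Q.contract a ha).double (Sum.inl b) else 0) -
          if Q.head b = Q.head a then arrow (Q.contract a ha).double (Sum.inl b) *
            arrow (Q.contract a ha).double (Sum.inr b) else 0) := by
  rw [contractArrow, dif_pos rfl, Finset.sum_sub_distrib, Finset.sum_filter, Finset.sum_filter]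

/-- The arrow `a` is excluded because its substitute 1 is not supported at a single vertex. -/
theorem contractArrow_mul_e {x : E ⊕ E} (hx : x ≠ Sum.inl a) :
    Q.contractArrow a ha x * e (Q.contract a ha).double (Q.fuse a ha (Q.double.tail x)) =
      Q.contractArrow a ha x := by
  rcases x with b | b
  · have h : b ≠ a := fun h => hx (by rw [h])
    rw [show b = (⟨b, h⟩ : {b // b ≠ a}).1 from rfl, contractArrow_inl]
    exact arrow_mul_e _ rfl
  · by_cases h : b = a
    · subst h
      rw [contractArrow_inr_self, Finset.sum_mul]
      refine Finset.sum_congr rfl fun c _ => ?_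
      rw [sub_mul, ite_mul, ite_mul, zero_mul, mul_assoc, mul_assoc]
      congr 1
      · refine ite_congr rfl (fun hc => ?_) fun _ => rfl
        rw [arrow_mul_e]
        exact congrArg (Q.fuse b ha) hc
      · refine ite_congr rfl (fun hc => ?_) fun _ => rfl
        rw [arrow_mul_e]
        exact congrArg (Q.fuse b ha) hc
    · rw [show b = (⟨b, h⟩ : {b // b ≠ a}).1 from rfl, contractArrow_inr]
      exact arrow_mul_e _ rfl

/-- For `x = a` both sides vanish, 1 having no derivative. Otherwise the idempotent is absorbed by
the substitute of `x` through the Leibniz rule. -/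
theorem slide_contractArrow_e_mul (c : {b : E // b ≠ a} ⊕ {b : E // b ≠ a}) (x : E ⊕ E)
    (u : (Q.contract a ha).double.PathAlgebra) :
    (Q.contract a ha).slide c (Q.contractArrow a ha x)
        (e (Q.contract a ha).double (Q.fuse a ha (Q.double.tail x)) * u) =
      (Q.contract a ha).slide c (Q.contractArrow a ha x) u := by
  by_cases hx : x = Sum.inl a
  · rw [hx, contractArrow_inl_self, slide_one]; rfl
  · have h := (Q.contract a ha).slide_mul c (Q.contractArrow_mem_grade a ha x)
      (e (Q.contract a ha).double (Q.fuse a ha (Q.double.tail x))) u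
    rw [slide_e, LinearMap.zero_apply, smul_zero, add_zero, Q.contractArrow_mul_e a ha hx] at h
    exact h.symm

/-- Chain rule for words, by the Leibniz rule one arrow at a time. The factor `sign y` cancels the
sign of `y` counted in `wordSlide y`; the sign of the arrow actually differentiated is supplied by
`slide c`. -/
theorem slide_contractWord (c : {b : E // b ≠ a} ⊕ {b : E // b ≠ a}) {i j : I}
    {w : List (E ⊕ E)} (h : Q.double.IsPath i w j) (z : Q.double.PathAlgebra)
    (hz : e Q.double j * z = z) (hz' : z * e Q.double i = z) :
    (Q.contract a ha).slide c (w.map (Q.contractArrow a ha)).prod (Q.contractMap a ha z) =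
      ∑ y, sign y • (Q.contract a ha).slide c (Q.contractArrow a ha y)
        (Q.contractMap a ha (Q.wordSlide y w z)) := by
  induction w generalizing i z with
  | nil => simp [wordSlide_nil]
  | cons x w ih =>
    obtain ⟨rfl, h⟩ := h
    have hs : ∀ x : E ⊕ E, sign x * sign x = 1 := fun x => by cases x <;> simp
    have ih := ih h (z * arrow Q.double x) (by rw [← mul_assoc, hz])
      (by rw [mul_assoc, arrow_mul_e x rfl])
    -- Passing the substituted first arrow behind the slot agrees with substituting in `z x`, which
    -- is the slot in the induction hypothesis.
    have h1 : Q.contractMap a ha (z * arrow Q.double x) =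
        Q.contractMap a ha z * Q.contractArrow a ha x := by
      rw [Q.contractMap_mul a ha hz' (e_mul_arrow x rfl), contractMap_arrow, ← mul_assoc,
        Q.contractMap_mul_e a ha hz']
    have h2 : Q.contractMap a ha (e Q.double (Q.double.tail x) * (w.map (arrow Q.double)).prod *
        z * e Q.double (Q.double.head x)) =
        e (Q.contract a ha).double (Q.fuse a ha (Q.double.tail x)) *
          ((w.map (Q.contractArrow a ha)).prod * Q.contractMap a ha z) := by
      rw [mul_assoc, hz', Q.contractMap_mul a ha (prod_mul_e h).symm hz, e_mul_prod h,
        contractMap_of, contractPath, mul_assoc]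
    simp only [wordSlide_cons, map_add, smul_add, Finset.sum_add_distrib, map_smul]
    rw [List.map_cons, List.prod_cons, slide_mul _ _ (Q.contractArrow_mem_grade a ha x), ← h1, ih]
    congr 1
    · rw [Finset.sum_eq_single x]
      · rw [if_pos rfl, map_smul, map_smul, smul_smul, hs, one_smul, h2, slide_contractArrow_e_mul]
      · intro y _ hy
        rw [if_neg (Ne.symm hy)]
        simp
      · simp
    · rw [Finset.smul_sum]
      refine Finset.sum_congr rfl fun y _ => ?_
      rw [smul_comm]
      rfl

/-- The chain rule for the contraction. -/
theorem superDeriv_contractNecklace (c : {b : E // b ≠ a} ⊕ {b : E // b ≠ a}) {r : ℕ}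
    (hr : Even r) {P : Q.Necklace} (hP : P ∈ Q.necklaceGrade r) :
    (Q.contract a ha).superDeriv c (Q.contractNecklace a ha P) =
      ∑ y, sign y • (Q.contract a ha).slide c (Q.contractArrow a ha y)
        (Q.contractMap a ha (Q.superDeriv y P)) := by
  refine necklaceGrade_induction
    (p := fun P => (Q.contract a ha).superDeriv c (Q.contractNecklace a ha P) =
      ∑ y, sign y • (Q.contract a ha).slide c (Q.contractArrow a ha y)
        (Q.contractMap a ha (Q.superDeriv y P))) ?_ ?_ ?_ ?_ hP
  · simp
  · intro x y hx hy
    simp only [map_add, smul_add, Finset.sum_add_distrib, hx, hy]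
  · intro t x hx
    simp only [map_smul, smul_comm _ t, ← Finset.smul_sum, hx]
  · intro i w h hw
    rw [contractNecklace_mkQ_of, superDeriv_mkQ _ _ hr
      (hw ▸ Q.contractPath_mem_grade a ha ⟨i, w, i, h⟩), contractPath, slide_e_mul, one_mul,
      ← contractMap_e, Q.slide_contractWord a ha c h _ (e_mul_e i) (e_mul_e i)]
    simp only [fun y => Q.superDeriv_mkQ_of y h (hw ▸ hr)]

end

/-! ### Derivatives of the contracted necklace -/

section

variable (Q : ArrowQuiver I E) (a : E) (ha : Q.head a ≠ Q.tail a)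

/-- Of all arrows `y` only two matter: `c` itself, with `sign c` appearing twice, and `a*`, with
sign -1. The arrow `a` becomes 1, and any other arrow becomes an arrow different from `c`. -/
theorem sum_slide_contractArrow (c : {b : E // b ≠ a} ⊕ {b : E // b ≠ a})
    (f : E ⊕ E → (Q.contract a ha).double.PathAlgebra) :
    ∑ y, sign y • (Q.contract a ha).slide c (Q.contractArrow a ha y) (f y) =
      e (Q.contract a ha).double ((Q.contract a ha).double.tail c) *
        f (c.map Subtype.val Subtype.val) *
        e (Q.contract a ha).double ((Q.contract a ha).double.head c) -
      (Q.contract a ha).slide c (Q.contractArrow a ha (Sum.inr a)) (f (Sum.inr a)) := by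
  rw [Fintype.sum_sum_type, Fintype.sum_eq_add_sum_subtype_ne _ a,
    Fintype.sum_eq_add_sum_subtype_ne (fun x => sign (Sum.inr x) • _) a]
  simp only [contractArrow_inl_self, slide_one, contractArrow_inl, contractArrow_inr, slide_arrow,
    sign_inl, sign_inr]
  rcases c with c | c <;> simp <;> abel

/-- Only the terms `b* b` and `b b*` with `b = c` contribute. In the first the derivative passes the
odd `b*`, producing a sign; in the second the sign is that of the sum over arrows with head `h(a)`.
The conditions on `u` let the idempotents in `slide` be absorbed. A loop at `h(a)` contributes both
terms. -/
theorem slide_contractArrow_inr_self_inl (c : {b : E // b ≠ a})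
    (u : (Q.contract a ha).double.PathAlgebra)
    (hu : e (Q.contract a ha).double (Q.fuse a ha (Q.head a)) * u = u)
    (hu' : u * e (Q.contract a ha).double (Q.fuse a ha (Q.head a)) = u) :
    (Q.contract a ha).slide (Sum.inl c) (Q.contractArrow a ha (Sum.inr a)) u =
      -(if Q.tail c = Q.head a then u * arrow (Q.contract a ha).double (Sum.inr c) else 0) -
      (if Q.head c = Q.head a then arrow (Q.contract a ha).double (Sum.inr c) * u else 0) := by
  rw [contractArrow_inr_self, map_sum, LinearMap.sum_apply, Finset.sum_eq_single c]
  · rw [map_sub, LinearMap.sub_apply]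
    congr 1
    · split_ifs with h
      · rw [slide_mul _ _ (arrow_inr_mem_grade _ _), slide_arrow, slide_arrow, if_pos rfl,
          if_neg (by simp), sign_inl, one_smul, ← mul_assoc, mul_assoc _ _ (e _ _),
          arrow_mul_e (i := (Q.contract a ha).double.head (Sum.inl c)) (Sum.inr c) rfl]
        have : (Q.contract a ha).double.tail (Sum.inl c) = Q.fuse a ha (Q.head a) :=
          congrArg (Q.fuse a ha) h
        rw [this, hu]
        simp
      · simp
    · split_ifs with h
      · rw [slide_mul _ _ (arrow_inl_mem_grade _ _), slide_arrow, slide_arrow, if_pos rfl,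
          if_neg (by simp), sign_inl, one_smul, ← mul_assoc,
          e_mul_arrow (i := (Q.contract a ha).double.tail (Sum.inl c)) (Sum.inr c) rfl]
        have : (Q.contract a ha).double.head (Sum.inl c) = Q.fuse a ha (Q.head a) :=
          congrArg (Q.fuse a ha) h
        rw [this, mul_assoc, hu']
        simp
      · simp
  · intro b _ hb
    rw [map_sub, LinearMap.sub_apply]
    have h1 := (Q.contract a ha).slide_mul (Sum.inl c) (arrow_inr_mem_grade (Q.contract a ha) b)
      (arrow (Q.contract a ha).double (Sum.inl b)) u
    have h2 := (Q.contract a ha).slide_mul (Sum.inl c) (arrow_inl_mem_grade (Q.contract a ha) b)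
      (arrow (Q.contract a ha).double (Sum.inr b)) u
    simp only [slide_arrow, Sum.inl.injEq, hb, reduceCtorEq, if_false, smul_zero, add_zero] at h1 h2
    split_ifs <;> simp [h1, h2]
  · simp

/-- Here both terms carry the sign -1 of the dual arrow being differentiated; subtraction turns the
second one positive. -/
theorem slide_contractArrow_inr_self_inr (c : {b : E // b ≠ a})
    (u : (Q.contract a ha).double.PathAlgebra)
    (hu : e (Q.contract a ha).double (Q.fuse a ha (Q.head a)) * u = u)
    (hu' : u * e (Q.contract a ha).double (Q.fuse a ha (Q.head a)) = u) :
    (Q.contract a ha).slide (Sum.inr c) (Q.contractArrow a ha (Sum.inr a)) u =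
      -(if Q.tail c = Q.head a then arrow (Q.contract a ha).double (Sum.inl c) * u else 0) +
      (if Q.head c = Q.head a then u * arrow (Q.contract a ha).double (Sum.inl c) else 0) := by
  rw [contractArrow_inr_self, map_sum, LinearMap.sum_apply, Finset.sum_eq_single c]
  · rw [map_sub, LinearMap.sub_apply, sub_eq_add_neg]
    congr 1
    · split_ifs with h
      · rw [slide_mul _ _ (arrow_inr_mem_grade _ _), slide_arrow, slide_arrow, if_pos rfl,
          if_neg (by simp), sign_inr, ← mul_assoc,
          e_mul_arrow (i := (Q.contract a ha).double.tail (Sum.inr c)) (Sum.inl c) rfl]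
        have : (Q.contract a ha).double.head (Sum.inr c) = Q.fuse a ha (Q.head a) :=
          congrArg (Q.fuse a ha) h
        rw [this, mul_assoc, hu']
        simp
      · simp
    · split_ifs with h
      · rw [slide_mul _ _ (arrow_inl_mem_grade _ _), slide_arrow, slide_arrow, if_pos rfl,
          if_neg (by simp), sign_inr, ← mul_assoc, mul_assoc _ _ (e _ _),
          arrow_mul_e (i := (Q.contract a ha).double.head (Sum.inr c)) (Sum.inl c) rfl]
        have : (Q.contract a ha).double.tail (Sum.inr c) = Q.fuse a ha (Q.head a) :=
          congrArg (Q.fuse a ha) h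
        rw [this, hu]
        simp
      · simp
  · intro b _ hb
    rw [map_sub, LinearMap.sub_apply]
    have h1 := (Q.contract a ha).slide_mul (Sum.inr c) (arrow_inr_mem_grade (Q.contract a ha) b)
      (arrow (Q.contract a ha).double (Sum.inl b)) u
    have h2 := (Q.contract a ha).slide_mul (Sum.inr c) (arrow_inl_mem_grade (Q.contract a ha) b)
      (arrow (Q.contract a ha).double (Sum.inr b)) u
    simp only [slide_arrow, Sum.inr.injEq, hb, reduceCtorEq, if_false, smul_zero, add_zero] at h1 h2
    split_ifs <;> simp [h1, h2]
  · simp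

theorem e_mul_contractMap_superDeriv {r : ℕ} (hr : Even r) {P : Q.Necklace}
    (hP : P ∈ Q.necklaceGrade r) (x : E ⊕ E) :
    e (Q.contract a ha).double (Q.fuse a ha (Q.double.tail x)) *
      Q.contractMap a ha (Q.superDeriv x P) = Q.contractMap a ha (Q.superDeriv x P) :=
  Q.e_mul_contractMap a ha (Q.e_mul_superDeriv x hr hP)

theorem contractMap_superDeriv_mul_e {r : ℕ} (hr : Even r) {P : Q.Necklace}
    (hP : P ∈ Q.necklaceGrade r) (x : E ⊕ E) :
    Q.contractMap a ha (Q.superDeriv x P) *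
      e (Q.contract a ha).double (Q.fuse a ha (Q.double.head x)) =
        Q.contractMap a ha (Q.superDeriv x P) :=
  Q.contractMap_mul_e a ha (Q.superDeriv_mul_e x hr hP)

theorem superDeriv_inl_contractNecklace {r : ℕ} (hr : Even r) {P : Q.Necklace}
    (hP : P ∈ Q.necklaceGrade r) (b : {b : E // b ≠ a}) :
    (Q.contract a ha).superDeriv (Sum.inl b) (Q.contractNecklace a ha P) =
      Q.contractMap a ha (Q.superDeriv (Sum.inl b) P) +
      (if Q.tail b = Q.head a then Q.contractMap a ha (Q.superDeriv (Sum.inr a) P) *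
        arrow (Q.contract a ha).double (Sum.inr b) else 0) +
      (if Q.head b = Q.head a then arrow (Q.contract a ha).double (Sum.inr b) *
        Q.contractMap a ha (Q.superDeriv (Sum.inr a) P) else 0) := by
  rw [Q.superDeriv_contractNecklace a ha _ hr hP, sum_slide_contractArrow,
    slide_contractArrow_inr_self_inl]
  · have h1 := Q.e_mul_contractMap_superDeriv a ha hr hP (Sum.inl b)
    have h2 := Q.contractMap_superDeriv_mul_e a ha hr hP (Sum.inl b)
    have h3 : (Q.contract a ha).double.tail (Sum.inl b) =
      Q.fuse a ha (Q.double.tail (Sum.inl b.1)) := rfl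
    have h4 : (Q.contract a ha).double.head (Sum.inl b) =
      Q.fuse a ha (Q.double.head (Sum.inl b.1)) := rfl
    rw [Sum.map_inl, h3, h4, h1, h2]
    abel
  · exact Q.e_mul_contractMap_superDeriv a ha hr hP (Sum.inr a)
  · rw [fuse_head]
    exact Q.contractMap_superDeriv_mul_e a ha hr hP (Sum.inr a)

theorem superDeriv_inr_contractNecklace {r : ℕ} (hr : Even r) {P : Q.Necklace}
    (hP : P ∈ Q.necklaceGrade r) (b : {b : E // b ≠ a}) :
    (Q.contract a ha).superDeriv (Sum.inr b) (Q.contractNecklace a ha P) =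
      Q.contractMap a ha (Q.superDeriv (Sum.inr b) P) +
      (if Q.tail b = Q.head a then arrow (Q.contract a ha).double (Sum.inl b) *
        Q.contractMap a ha (Q.superDeriv (Sum.inr a) P) else 0) -
      (if Q.head b = Q.head a then Q.contractMap a ha (Q.superDeriv (Sum.inr a) P) *
        arrow (Q.contract a ha).double (Sum.inl b) else 0) := by
  rw [Q.superDeriv_contractNecklace a ha _ hr hP, sum_slide_contractArrow,
    slide_contractArrow_inr_self_inr]
  · have h1 := Q.e_mul_contractMap_superDeriv a ha hr hP (Sum.inr b)
    have h2 := Q.contractMap_superDeriv_mul_e a ha hr hP (Sum.inr b)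
    have h3 : (Q.contract a ha).double.tail (Sum.inr b) =
      Q.fuse a ha (Q.double.tail (Sum.inr b.1)) := rfl
    have h4 : (Q.contract a ha).double.head (Sum.inr b) =
      Q.fuse a ha (Q.double.head (Sum.inr b.1)) := rfl
    rw [Sum.map_inr, h3, h4, h1, h2]
    abel
  · exact Q.e_mul_contractMap_superDeriv a ha hr hP (Sum.inr a)
  · rw [fuse_head]
    exact Q.contractMap_superDeriv_mul_e a ha hr hP (Sum.inr a)

/-! ### The moment map identity at the head of `a` -/

theorem contractMap_e_mul_superDeriv_mul_arrow {r : ℕ} (hr : Even r) {P : Q.Necklace}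
    (hP : P ∈ Q.necklaceGrade r) (j : I) (x : E ⊕ E) :
    Q.contractMap a ha (e Q.double j * (Q.superDeriv x P * arrow Q.double x)) =
      if Q.double.tail x = j then
        Q.contractMap a ha (Q.superDeriv x P) * Q.contractArrow a ha x else 0 := by
  split_ifs with h
  · rw [← mul_assoc, ← h, Q.e_mul_superDeriv x hr hP,
      Q.contractMap_mul a ha (Q.superDeriv_mul_e x hr hP) (e_mul_arrow x rfl), contractMap_arrow,
      ← mul_assoc, Q.contractMap_superDeriv_mul_e a ha hr hP]
  · rw [← Q.e_mul_superDeriv x hr hP]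
    simp only [← mul_assoc]
    rw [e_mul_e_of_ne (Ne.symm h)]
    simp

theorem contractMap_e_mul_arrow_mul_superDeriv {r : ℕ} (hr : Even r) {P : Q.Necklace}
    (hP : P ∈ Q.necklaceGrade r) (j : I) (x : E ⊕ E) :
    Q.contractMap a ha (e Q.double j * (arrow Q.double x * Q.superDeriv x P)) =
      if Q.double.head x = j then
        Q.contractArrow a ha x * Q.contractMap a ha (Q.superDeriv x P) else 0 := by
  split_ifs with h
  · rw [← mul_assoc, e_mul_arrow x h.symm,
      Q.contractMap_mul a ha (arrow_mul_e x rfl) (Q.e_mul_superDeriv x hr hP), contractMap_arrow,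
      e_mul_contractArrow, mul_assoc, Q.e_mul_contractMap_superDeriv a ha hr hP]
  · rw [← e_mul_arrow x rfl]
    simp only [← mul_assoc]
    rw [e_mul_e_of_ne (Ne.symm h)]
    simp

/-- The moment map identity at the head of `a`, after contraction. -/
theorem contractMap_moment {r : ℕ} (hr : Even r) {P : Q.Necklace} (hP : P ∈ Q.necklaceGrade r) :
    Q.contractMap a ha (Q.superDeriv (Sum.inr a) P) * Q.contractArrow a ha (Sum.inr a) +
      ∑ b : {b : E // b ≠ a},
        ((if Q.tail b = Q.head a then Q.contractMap a ha (Q.superDeriv (Sum.inl b) P) *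
          arrow (Q.contract a ha).double (Sum.inl b) else 0) +
        (if Q.head b = Q.head a then Q.contractMap a ha (Q.superDeriv (Sum.inr b) P) *
          arrow (Q.contract a ha).double (Sum.inr b) else 0)) =
    Q.contractMap a ha (Q.superDeriv (Sum.inl a) P) +
      ∑ b : {b : E // b ≠ a},
        ((if Q.head b = Q.head a then arrow (Q.contract a ha).double (Sum.inl b) *
          Q.contractMap a ha (Q.superDeriv (Sum.inl b) P) else 0) -
        (if Q.tail b = Q.head a then arrow (Q.contract a ha).double (Sum.inr b) *
          Q.contractMap a ha (Q.superDeriv (Sum.inr b) P) else 0)) := by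
  -- The identity is cut down to `h(a)` before substituting; once the two ends of `a` are fused,
  -- their components could no longer be separated.
  have key := congrArg (fun x => Q.contractMap a ha (e Q.double (Q.head a) * x))
    (Q.sum_superDeriv_mul_arrow hr hP)
  simp only [Finset.mul_sum, mul_smul_comm, map_sum, map_smul,
    Q.contractMap_e_mul_superDeriv_mul_arrow a ha hr hP,
    Q.contractMap_e_mul_arrow_mul_superDeriv a ha hr hP] at key
  rw [Fintype.sum_sum_type, Fintype.sum_sum_type, Fintype.sum_eq_add_sum_subtype_ne _ a,
    Fintype.sum_eq_add_sum_subtype_ne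
      (fun x => if Q.double.tail (Sum.inr x) = Q.head a then _ else _) a,
    Fintype.sum_eq_add_sum_subtype_ne (fun x => sign (Sum.inl x) • _) a,
    Fintype.sum_eq_add_sum_subtype_ne (fun x => sign (Sum.inr x) • _) a] at key
  have h1 : ∀ b, Q.double.tail (Sum.inl b) = Q.tail b := fun _ => rfl
  have h2 : ∀ b, Q.double.tail (Sum.inr b) = Q.head b := fun _ => rfl
  have h3 : ∀ b, Q.double.head (Sum.inl b) = Q.head b := fun _ => rfl
  have h4 : ∀ b, Q.double.head (Sum.inr b) = Q.tail b := fun _ => rfl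
  -- As `t(a) ≠ h(a)`, among the terms of `a` and `a*` only `D_{a*}(P) a*` and `a D_a(P)` survive
  -- the cut, and the latter becomes `D_a(P)` since `a` is replaced by 1.
  simp only [h1, h2, h3, h4, if_neg ha.symm, if_true, contractArrow_inl, contractArrow_inr,
    contractArrow_inl_self, sign_inl, sign_inr, one_smul, one_mul, smul_zero, zero_add, neg_smul,
    Finset.sum_neg_distrib] at key
  rw [Finset.sum_add_distrib, Finset.sum_sub_distrib, sub_eq_add_neg, add_left_comm, key, add_assoc]

/-! ### The bracket of the contracted necklace -/

/-- Every term of the product has degree 3, so rotations cost no sign and each correction term can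
be turned until `Y` stands last. `T` and `S` stand for tail and head of `b` being at `h(a)`. If both
hold, `b` is a loop, and the mixed terms `B Y B' Y` and `Y B Y B'` cancel by `e6`. -/
theorem mkQ_mul_add_commutators {M N Y B B' : Q.double.PathAlgebra} (hM : M ∈ Q.grade 2)
    (hN : N ∈ Q.grade 1) (hY : Y ∈ Q.grade 1) (hB : B ∈ Q.grade 0) (hB' : B' ∈ Q.grade 1)
    (T S : Prop) [Decidable T] [Decidable S] :
    Q.superCommutators.mkQ ((N + (if T then B * Y else 0) - (if S then Y * B else 0)) *
      (M + (if T then Y * B' else 0) + (if S then B' * Y else 0))) =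
    Q.superCommutators.mkQ (N * M) +
    Q.superCommutators.mkQ ((((if T then M * B else 0) + (if S then N * B' else 0)) -
      ((if S then B * M else 0) - (if T then B' * N else 0)) +
      ((if T then B' * B else 0) - if S then B * B' else 0) * Y) * Y) := by
  have e1 := Q.mkQ_mul_comm hB' (grade_mul hN hY) (by decide)
  have e2 := Q.mkQ_mul_comm (grade_mul hB hY) hM (by decide)
  have e3 := Q.mkQ_mul_comm hY (grade_mul hB hM) (by decide)
  have e4 := Q.mkQ_mul_comm hB' (grade_mul (grade_mul hB hY) hY) (by decide)
  have e5 := Q.mkQ_mul_comm hY (grade_mul (grade_mul hB hB') hY) (by decide)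
  have e6 := Q.mkQ_mul_comm hY (grade_mul (grade_mul hB hY) hB') (by decide)
  simp only [mul_assoc] at e1 e2 e3 e4 e5 e6
  generalize Q.superCommutators.mkQ = f at *
  by_cases hT : T <;> by_cases hS : S <;>
  · simp only [hT, hS, if_true, if_false, add_mul, mul_add, sub_mul, map_add, map_sub, mul_assoc,
      zero_mul, map_zero, add_zero, zero_add, sub_zero, zero_sub, map_neg,
      neg_mul, e1, e2, e3, e4, e5, e6]
    try abel

/-- The contribution of an arrow to the bracket of the contracted necklace with itself, as a
necklace. -/
theorem mkQ_superDeriv_mul_superDeriv {P : Q.Necklace} (hP : P ∈ Q.necklaceGrade 2)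
    (b : {b : E // b ≠ a}) :
    (Q.contract a ha).superCommutators.mkQ
      ((Q.contract a ha).superDeriv (Sum.inr b) (Q.contractNecklace a ha P) *
        (Q.contract a ha).superDeriv (Sum.inl b) (Q.contractNecklace a ha P)) =
    (Q.contract a ha).superCommutators.mkQ
      (Q.contractMap a ha (Q.superDeriv (Sum.inr b) P) *
        Q.contractMap a ha (Q.superDeriv (Sum.inl b) P)) +
    (Q.contract a ha).superCommutators.mkQ
      ((((if Q.tail b = Q.head a then Q.contractMap a ha (Q.superDeriv (Sum.inl b) P) *
          arrow (Q.contract a ha).double (Sum.inl b) else 0) +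
        (if Q.head b = Q.head a then Q.contractMap a ha (Q.superDeriv (Sum.inr b) P) *
          arrow (Q.contract a ha).double (Sum.inr b) else 0)) -
        ((if Q.head b = Q.head a then arrow (Q.contract a ha).double (Sum.inl b) *
          Q.contractMap a ha (Q.superDeriv (Sum.inl b) P) else 0) -
        (if Q.tail b = Q.head a then arrow (Q.contract a ha).double (Sum.inr b) *
          Q.contractMap a ha (Q.superDeriv (Sum.inr b) P) else 0)) +
        ((if Q.tail b = Q.head a then arrow (Q.contract a ha).double (Sum.inr b) *
            arrow (Q.contract a ha).double (Sum.inl b) else 0) -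
          if Q.head b = Q.head a then arrow (Q.contract a ha).double (Sum.inl b) *
            arrow (Q.contract a ha).double (Sum.inr b) else 0) *
        Q.contractMap a ha (Q.superDeriv (Sum.inr a) P)) *
        Q.contractMap a ha (Q.superDeriv (Sum.inr a) P)) := by
  rw [Q.superDeriv_inl_contractNecklace a ha even_two hP,
    Q.superDeriv_inr_contractNecklace a ha even_two hP]
  have hM := Q.contractMap_mem_grade a ha
    (Q.superDeriv_mem_grade (Sum.inl b.1) even_two (s := 2) rfl hP)
  have hN := Q.contractMap_mem_grade a ha
    (Q.superDeriv_mem_grade (Sum.inr b.1) even_two (s := 1) rfl hP)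
  have hY := Q.contractMap_mem_grade a ha
    (Q.superDeriv_mem_grade (Sum.inr a) even_two (s := 1) rfl hP)
  have hB := arrow_inl_mem_grade (Q.contract a ha) b
  have hB' := arrow_inr_mem_grade (Q.contract a ha) b
  exact (Q.contract a ha).mkQ_mul_add_commutators hM hN hY hB hB' _ _

theorem isPoisson_contractNecklace {P : Q.Necklace} (hP : Q.IsPoisson P) :
    (Q.contract a ha).IsPoisson (Q.contractNecklace a ha P) := by
  rw [isPoisson_iff] at hP ⊢
  obtain ⟨hP, hbr⟩ := hP
  refine ⟨Q.contractNecklace_mem_necklaceGrade a ha hP, ?_⟩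
  -- The contraction of the vanishing sum for `P` is compared with the sum for the contracted
  -- necklace; the former has one more term, that of `a`.
  have hbr := congrArg (Q.contractNecklace a ha) hbr
  have hb : ∀ b, Q.contractNecklace a ha (Q.superCommutators.mkQ
      (Q.superDeriv (Sum.inr b) P * Q.superDeriv (Sum.inl b) P)) =
      (Q.contract a ha).superCommutators.mkQ
        (Q.contractMap a ha (Q.superDeriv (Sum.inr b) P) *
          Q.contractMap a ha (Q.superDeriv (Sum.inl b) P)) := by
    intro b
    have h1 := Q.e_mul_superDeriv (Sum.inr b) even_two hP
    have h2 := Q.superDeriv_mul_e (Sum.inr b) even_two hP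
    have h3 := Q.e_mul_superDeriv (Sum.inl b) even_two hP
    have h4 : Q.superDeriv (Sum.inl b) P * e Q.double (Q.double.tail (Sum.inr b)) =
      Q.superDeriv (Sum.inl b) P := Q.superDeriv_mul_e (Sum.inl b) even_two hP
    rw [← Q.contractMap_mul a ha h2 h3]
    exact Q.contractNecklace_mkQ a ha (by rw [← mul_assoc, h1]) (by rw [mul_assoc, h4])
  rw [map_sum, map_sum, map_zero] at hbr
  simp only [hb] at hbr
  rw [Fintype.sum_eq_add_sum_subtype_ne _ a] at hbr
  rw [map_sum]
  simp only [Q.mkQ_superDeriv_mul_superDeriv a ha hP]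
  -- The old sum over `b ≠ a` equals minus the term of `a`, and the quadratic corrections sum to the
  -- substitute of `a*`.
  rw [Finset.sum_add_distrib, eq_neg_of_add_eq_zero_right hbr, ← map_sum, ← Finset.sum_mul,
    Finset.sum_add_distrib,
    ← Finset.sum_mul, ← contractArrow_inr_self, Finset.sum_sub_distrib]
  have hm := Q.contractMap_moment a ha even_two hP
  have hM := Q.contractMap_mem_grade a ha
    (Q.superDeriv_mem_grade (Sum.inl a) even_two (s := 2) rfl hP)
  have hY := Q.contractMap_mem_grade a ha
    (Q.superDeriv_mem_grade (Sum.inr a) even_two (s := 1) rfl hP)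
  have hA : Q.contractArrow a ha (Sum.inr a) ∈ (Q.contract a ha).grade 1 :=
    Q.contractArrow_mem_grade a ha (Sum.inr a)
  -- In the notation above: `Y A Y` equals `A Y Y`, and `Y M_a` equals `M_a Y`. The moment identity
  -- then makes everything cancel.
  have comm := (Q.contract a ha).mkQ_mul_comm hY (grade_mul hA hY) (by decide)
  have comm' := (Q.contract a ha).mkQ_mul_comm hY hM (by decide)
  rw [← eq_sub_iff_add_eq'] at hm
  rw [hm, add_sub_right_comm, add_sub_cancel_right, neg_add_eq_zero, add_mul, sub_mul,
    map_add, map_sub, comm', ← comm, mul_assoc, sub_add_cancel]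

end

end ArrowQuiver

end

theorem mainTheorem4 {I E : Type*} [Fintype I] [DecidableEq I] [Fintype E] [DecidableEq E]
    (Q : ArrowQuiver I E) (a : E) (ha : Q.head a ≠ Q.tail a)
    (P : Q.Necklace) (hP : Q.IsPoisson P) :
    (Q.contract a ha).IsPoisson (Q.contractNecklace a ha P) :=
  Q.isPoisson_contractNecklace a ha hP
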